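/- Let $1\le p\le 2$ and let $\phi\in\mathcal S(\mathbf R)\setminus\{0\}$. For $f\in\mathcal S'(\mathbf R)$ let $V_\phi f(x,\xi)=\langle f, M_\xi T_x\phi\rangle$, where $(M_\xi T_x\phi)(t)=e^{it\xi}\phi(t-x)$ and $\langle\cdot,\cdot\rangle$ extends $\langle F,G\rangle=\int F(t)\overline{G(t)}\,dt$ to $\mathcal S'\times\mathcal S$, and let the modulation space $M^{p,1}(\mathbf R)$ consist of all $f\in\mathcal S'(\mathbf R)$ with $$\|f\|_{M^{p,1}}=\int_{\mathbf R}\Big(\int_{\mathbf R}|V_\phi f(x,\xi)|^p\,dx\Big)^{1/p}d\xi<\infty .$$ Let the Fourier Segal algebra $\mathcal FA_p(\mathbf R)$ consist of all $f\in\mathcal S'(\mathbf R)$ with $f\in L^p(\mathbf R)$ and $\widehat f\in L^1(\mathbf R)$, with the norm $\|f\|_{\mathcal FA_p}=\|f\|_{L^p}+\|\widehat f\|_{L^1}$, where $\widehat f$ is the Fourier transform on $\mathcal S'(\mathbf R)$ that extends $\widehat f(\xi)=\int_{\mathbf R} f(x)e^{-ix\xi}\,dx$. Then $M^{p,1}(\mathbf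 R)\subsetneq\mathcal FA_p(\mathbf R)$, and $M^{p,1}(\mathbf R)$ is dense in $\mathcal FA_p(\mathbf R)$ with respect to $\|\cdot\|_{\mathcal FA_p}$. -/

import Mathlib

open MeasureTheory SchwartzMap FourierTransform
open scoped ENNReal ComplexConjugate

namespace ModulationFourierSegal

/-- The character `t ↦ e^{-itξ}` has temperate growth, so that it multiplies the Schwartz space
into itself. -/
theorem hasTemperateGrowth_character (ξ : ℝ) :
    Function.HasTemperateGrowth (fun t : ℝ ↦ Complex.exp (-(Complex.I * t * ξ))) := by
  have hE : (fun t : ℝ ↦ Complex.exp (-(Complex.I * t * ξ))) =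
      fun t : ℝ ↦ Complex.exp ((-(Complex.I * ξ)) * t) := by
    funext t; congr 1; ring
  rw [hE]
  have hc : ContDiff ℝ ((⊤ : ℕ∞) : WithTop ℕ∞) (fun t : ℝ ↦ (t : ℂ)) :=
    Complex.ofRealCLM.contDiff
  refine ⟨(contDiff_const.mul hc).cexp, fun n ↦ ⟨0, |ξ| ^ n, fun x ↦ ?_⟩⟩
  have hder : ∀ n : ℕ, iteratedDeriv n (fun t : ℝ ↦ Complex.exp ((-(Complex.I * ξ)) * t)) =
      fun t : ℝ ↦ (-(Complex.I * ξ)) ^ n * Complex.exp ((-(Complex.I * ξ)) * t) := by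
    intro n
    induction n with
    | zero => simp
    | succ k ih =>
      rw [iteratedDeriv_succ, ih]
      funext t
      have h1 : HasDerivAt (fun t : ℝ ↦ (-(Complex.I * ξ)) * (t : ℂ)) (-(Complex.I * ξ)) t := by
        simpa using (Complex.ofRealCLM.hasDerivAt (x := t)).const_mul (-(Complex.I * (ξ : ℂ)))
      have h2 := (h1.cexp.const_mul ((-(Complex.I * (ξ : ℂ))) ^ k)).deriv
      rw [h2]; ring
  rw [norm_iteratedFDeriv_eq_norm_iteratedDeriv, hder]
  have : ‖Complex.exp ((-(Complex.I * ξ)) * x)‖ = 1 := by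
    rw [Complex.norm_exp]; simp
  rw [norm_mul, this]
  simp

/-- The Schwartz function `t ↦ conj (φ (t - x)) * e^{-itξ}`, that is, the complex conjugate of
the time-frequency shift `M_ξ T_x φ` of the window `φ`. -/
noncomputable def conjShift (φ : 𝓢(ℝ, ℂ)) (x ξ : ℝ) : 𝓢(ℝ, ℂ) :=
  smulLeftCLM ℂ (fun t : ℝ ↦ Complex.exp (-(Complex.I * t * ξ)))
    (((φ.compSubConstCLM ℝ x)).postcompCLM Complex.conjCLE.toContinuousLinearMap)

theorem conjShift_apply (φ : 𝓢(ℝ, ℂ)) (x ξ t : ℝ) :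
    conjShift φ x ξ t = conj (φ (t - x)) * Complex.exp (-(Complex.I * t * ξ)) := by
  rw [conjShift, smulLeftCLM_apply_apply (hasTemperateGrowth_character ξ)]
  simp [postcompCLM_apply, mul_comm]

/-- The short-time Fourier transform of a tempered distribution `u` with window `φ`:
`V_φ u (x, ξ) = ⟨u, M_ξ T_x φ⟩`, where `⟨·, ·⟩` is conjugate-linear in the second slot; for a
function `u` this is `∫ u(t) conj(φ(t - x)) e^{-itξ} dt`. -/
noncomputable def stft (φ : 𝓢(ℝ, ℂ)) (u : 𝓢'(ℝ, ℂ)) (x ξ : ℝ) : ℂ :=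
  u (conjShift φ x ξ)

/-- The (extended) norm of the unweighted modulation space `M^{p,q}(ℝ)` computed with the window
`φ`: the `L^q` norm in `ξ` of the `L^p` norm in `x` of `V_φ u (x, ξ)`. -/
noncomputable def modulationENorm (φ : 𝓢(ℝ, ℂ)) (p q : ℝ≥0∞) (u : 𝓢'(ℝ, ℂ)) : ℝ≥0∞ :=
  eLpNorm (fun ξ : ℝ ↦ eLpNorm (fun x : ℝ ↦ stft φ u x ξ) p volume) q volume

/-- The modulation space `M^{p,q}(ℝ)`, defined with the window `φ`. -/
def modulationSpace (φ : 𝓢(ℝ, ℂ)) (p q : ℝ≥0∞) : Set 𝓢'(ℝ, ℂ) :=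
  {u | modulationENorm φ p q u < ∞}

/-- The Fourier transform `φ̂(ξ) = ∫ φ(x) e^{-ixξ} dx` on the Schwartz space; it is Mathlib's
Fourier transform evaluated at `ξ / (2π)`. -/
noncomputable def fourierSchwartz : 𝓢(ℝ, ℂ) →L[ℂ] 𝓢(ℝ, ℂ) :=
  (compCLMOfContinuousLinearEquiv ℂ (ContinuousLinearEquiv.unitsEquivAut ℝ
    (Units.mk0 (2 * Real.pi)⁻¹ (inv_ne_zero Real.two_pi_pos.ne')))) ∘L (fourierCLM ℂ 𝓢(ℝ, ℂ))

theorem fourierSchwartz_apply (φ : 𝓢(ℝ, ℂ)) (ξ : ℝ) :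
    fourierSchwartz φ ξ = ∫ x : ℝ, φ x * Complex.exp (-(Complex.I * x * ξ)) := by
  have h : fourierSchwartz φ ξ = 𝓕 (φ : ℝ → ℂ) (ξ * (2 * Real.pi)⁻¹) := by
    simp [fourierSchwartz, SchwartzMap.fourier_coe]
  rw [h, Real.fourier_real_eq_integral_exp_smul]
  refine integral_congr_ae (Filter.Eventually.of_forall fun x ↦ ?_)
  simp only [smul_eq_mul]
  rw [mul_comm]
  congr 2
  push_cast
  have : (Real.pi : ℂ) ≠ 0 := by exact_mod_cast Real.pi_ne_zero
  field_simp

/-- The Fourier transform of tempered distributions, `û(φ) = u(φ̂)`. -/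
noncomputable def fourierDistribution (u : 𝓢'(ℝ, ℂ)) : 𝓢'(ℝ, ℂ) :=
  PointwiseConvergenceCLM.precomp ℂ fourierSchwartz u

theorem fourierDistribution_apply (u : 𝓢'(ℝ, ℂ)) (φ : 𝓢(ℝ, ℂ)) :
    fourierDistribution u φ = u (fourierSchwartz φ) := rfl

/-- The (extended) `L^p` norm of a tempered distribution: it is `‖f‖_{L^p}` if the distribution is
given by the function `f ∈ L^p(ℝ)`, and it is `∞` if there is no such `f`. -/
noncomputable def lpENorm (p : ℝ≥0∞) [Fact (1 ≤ p)] (u : 𝓢'(ℝ, ℂ)) : ℝ≥0∞ :=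
  ⨅ (f : Lp ℂ p (volume : Measure ℝ)) (_ : Lp.toTemperedDistribution f = u), ‖f‖ₑ

theorem lpENorm_toTemperedDistribution (p : ℝ≥0∞) [Fact (1 ≤ p)]
    (f : Lp ℂ p (volume : Measure ℝ)) : lpENorm p (Lp.toTemperedDistribution f) = ‖f‖ₑ := by
  have hinj := LinearMap.ker_eq_bot.1
    (Lp.ker_toTemperedDistributionCLM_eq_bot (F := ℂ) (μ := (volume : Measure ℝ)) (p := p))
  refine le_antisymm (iInf_le_of_le f (iInf_le _ rfl)) (le_iInf₂ fun g hg ↦ ?_)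
  rw [show g = f from hinj hg]

theorem lpENorm_lt_top_iff (p : ℝ≥0∞) [Fact (1 ≤ p)] (u : 𝓢'(ℝ, ℂ)) :
    lpENorm p u < ∞ ↔ ∃ f : Lp ℂ p (volume : Measure ℝ), Lp.toTemperedDistribution f = u := by
  constructor
  · intro h
    by_contra! hne
    simp [lpENorm, hne] at h
  · rintro ⟨f, rfl⟩
    rw [lpENorm_toTemperedDistribution]
    exact enorm_lt_top

/-- The (extended) norm `‖u‖_{L^p} + ‖û‖_{L^1}` of the Fourier Segal algebra. -/
noncomputable def fourierSegalENorm (p : ℝ≥0∞) [Fact (1 ≤ p)] (u : 𝓢'(ℝ, ℂ)) : ℝ≥0∞ :=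
  lpENorm p u + lpENorm 1 (fourierDistribution u)

/-- The Fourier Segal algebra `FA_p(ℝ)`: all `u` in `L^p(ℝ)` with `û` in `L^1(ℝ)`. -/
def fourierSegalAlgebra (p : ℝ≥0∞) [Fact (1 ≤ p)] : Set 𝓢'(ℝ, ℂ) :=
  {u | fourierSegalENorm p u < ∞}

end ModulationFourierSegal

namespace ModulationFourierSegal

open scoped BoundedContinuousFunction

/-! Everything rests on the inversion formula `integral_ambiguity_mul_stft`: integrating `V_φ u`
against the cross-ambiguity function of `ψ` and `φ` returns `2π‖φ‖² u(ψ)`, for every tempered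
distribution `u`.

Inclusion. Testing the formula on `ψ = conj (M_η T_y φ)` bounds `|V_φ u|` by its convolution with a
rapidly decaying kernel. For `u ∈ M^{p,1}` this gives `|V_φ u(x, ξ)| ≤ M(ξ)` with `M` integrable
(`exists_enorm_stft_le`). Interpolating between this sup bound and the `L^p` norm in `x` gives
`M^{p,1} ⊆ M^{2,1}`; here `p ≤ 2` enters. The formula also writes `u` as a superposition of
time-frequency shifts of `φ`, which lies in `L^p` by Minkowski's inequality
(`exists_toTemperedDistribution_eq`). For `û`, Plancherel at fixed `ξ` turns `u ∈ M^{2,1}` into `∫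
‖û · conj φ̂(· - ξ)‖₂ dξ < ∞`, that is, `û ∈ W(L², ℓ¹)`, and this amalgam space embeds in `L¹`.

Density. Averaging translates of `f ∈ L^p` against a Schwartz function `η` lands in `M^{p,1}`
(`mollify_mem_modulationSpace`). On the Fourier side it multiplies `f̂` by the bounded function
`η̂(-ω)`. Along an approximate identity both parts of the norm converge.

Strictness. Take `û` to be, up to reflection and the factor `2π`, a train `g = ∑ a_n K_n β(K_n(t -
n))` of ever narrower bumps. Summability of `a_n` and of `a_n² K_n³` puts `g` and `ĝ` in `L¹`.
Divergence of `∑ a_n √K_n` keeps `g` out of `W(L², ℓ¹)`, so `u = ĝ` is not in `M^{2,1}`, which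
contains `M^{p,1}`. -/

/-! ### Tempered distributions under integrals of Schwartz functions -/

theorem hasTemperateGrowth_ofReal_pow (k : ℕ) :
    Function.HasTemperateGrowth (fun y : ℝ ↦ (y : ℂ) ^ k) := by
  have : Function.HasTemperateGrowth (fun y : ℝ ↦ (y : ℂ)) :=
    Complex.ofRealCLM.hasTemperateGrowth
  exact this.pow k

/-- The map `ψ ↦ y ^ k ∂ⁿψ(y)` from the Schwartz space to the bounded continuous functions. -/
noncomputable def weightedDeriv (k n : ℕ) : 𝓢(ℝ, ℂ) →L[ℂ] (ℝ →ᵇ ℂ) :=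
  (toBoundedContinuousFunctionCLM ℂ ℝ ℂ) ∘L
    (smulLeftCLM ℂ (fun y : ℝ ↦ (y : ℂ) ^ k)) ∘L ((derivCLM ℂ ℂ) ^ n)

theorem derivCLM_pow_apply (n : ℕ) (ψ : 𝓢(ℝ, ℂ)) (y : ℝ) :
    ((derivCLM ℂ ℂ) ^ n) ψ y = iteratedDeriv n ψ y := by
  induction n generalizing ψ with
  | zero => simp
  | succ n ih =>
    rw [pow_succ, mul_apply_eq_comp, ih, iteratedDeriv_succ']
    rfl

theorem weightedDeriv_apply (k n : ℕ) (ψ : 𝓢(ℝ, ℂ)) (y : ℝ) :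
    weightedDeriv k n ψ y = (y : ℂ) ^ k * ((derivCLM ℂ ℂ) ^ n) ψ y := by
  simp [weightedDeriv, smulLeftCLM_apply_apply (hasTemperateGrowth_ofReal_pow k)]

theorem norm_weightedDeriv (k n : ℕ) (ψ : 𝓢(ℝ, ℂ)) :
    ‖weightedDeriv k n ψ‖ = SchwartzMap.seminorm ℂ k n ψ := by
  apply le_antisymm
  · refine (BoundedContinuousFunction.norm_le (apply_nonneg _ _)).2 fun y ↦ ?_
    rw [weightedDeriv_apply, norm_mul, norm_pow, Complex.norm_real, derivCLM_pow_apply,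
      Real.norm_eq_abs]
    exact le_seminorm' ℂ k n ψ y
  · refine seminorm_le_bound' ℂ k n ψ (norm_nonneg _) fun y ↦ ?_
    have := (weightedDeriv k n ψ).norm_coe_le_norm y
    rwa [weightedDeriv_apply, norm_mul, norm_pow, Complex.norm_real, derivCLM_pow_apply,
      Real.norm_eq_abs] at this

/-- Hahn–Banach: `u ∘ J⁻¹` is bounded on the range of `J`. This moves a functional from a space
without a norm to a Banach space. -/
theorem exists_extension_of_injective {V B : Type*} [AddCommGroup V] [Module ℂ V]
    [NormedAddCommGroup B] [NormedSpace ℂ B] (J : V →ₗ[ℂ] B) (hJ : Function.Injective J)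
    (u : V →ₗ[ℂ] ℂ) (C : ℝ) (hb : ∀ ψ, ‖u ψ‖ ≤ C * ‖J ψ‖) :
    ∃ g : B →L[ℂ] ℂ, ∀ ψ, g (J ψ) = u ψ := by
  let e := LinearEquiv.ofInjective J hJ
  have he : ∀ ψ, (e ψ : B) = J ψ := fun ψ ↦ rfl
  let f : StrongDual ℂ (LinearMap.range J) :=
    LinearMap.mkContinuous (u ∘ₗ (e.symm : _ →ₗ[ℂ] V)) C (by
      intro b
      obtain ⟨ψ, rfl⟩ := e.surjective b
      simpa [he] using hb ψ)
  obtain ⟨g, hg, -⟩ := exists_extension_norm_eq (LinearMap.range J) f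
  refine ⟨g, fun ψ ↦ ?_⟩
  have := hg (e ψ)
  simpa [f, he] using this

/-- A tempered distribution is a continuous functional of finitely many weighted derivatives. -/
theorem exists_eq_weightedDeriv (u : 𝓢'(ℝ, ℂ)) :
    ∃ (s : Finset (ℕ × ℕ)) (L : (s → ℝ →ᵇ ℂ) →L[ℂ] ℂ),
      ∀ ψ, u ψ = L (fun i ↦ weightedDeriv i.1.1 i.1.2 ψ) := by
  classical
  obtain ⟨s, C, -, hC⟩ := Seminorm.bound_of_continuous (schwartz_withSeminorms ℂ ℝ ℂ)
    ((normSeminorm ℂ ℂ).comp (u : 𝓢(ℝ, ℂ) →ₗ[ℂ] ℂ))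
    (continuous_norm.comp (map_continuous u))
  -- The index `(0, 0)` is added because its component is `ψ` itself, which makes `J` injective.
  let J : 𝓢(ℝ, ℂ) →ₗ[ℂ] (↥(insert (0, 0) s) → ℝ →ᵇ ℂ) :=
    LinearMap.pi fun i ↦ (weightedDeriv i.1.1 i.1.2 : 𝓢(ℝ, ℂ) →ₗ[ℂ] (ℝ →ᵇ ℂ))
  have hJ : Function.Injective J := by
    intro ψ ψ' h
    ext y
    have h0 := congrFun h ⟨(0, 0), Finset.mem_insert_self _ _⟩
    have := congrArg (fun b : ℝ →ᵇ ℂ ↦ b y) h0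
    simpa [J, weightedDeriv_apply] using this
  have hb : ∀ ψ, ‖u ψ‖ ≤ C * ‖J ψ‖ := by
    intro ψ
    refine (hC ψ).trans ?_
    rw [smul_apply, NNReal.smul_def, smul_eq_mul]
    gcongr
    refine Seminorm.finset_sup_apply_le (norm_nonneg _) fun i hi ↦ ?_
    have := norm_le_pi_norm (J ψ) ⟨i, Finset.mem_insert_of_mem hi⟩
    refine le_trans (le_of_eq ?_) this
    exact (norm_weightedDeriv i.1 i.2 ψ).symm
  obtain ⟨g, hg⟩ := exists_extension_of_injective J hJ (u : 𝓢(ℝ, ℂ) →ₗ[ℂ] ℂ) C hb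
  exact ⟨insert (0, 0) s, g, fun ψ ↦ (hg ψ).symm⟩

section integral

variable {X : Type*} [MeasurableSpace X] [TopologicalSpace X] [BorelSpace X]
  [SecondCountableTopology X] {μ : Measure X}

theorem integrable_weightedDeriv {Φ : X → 𝓢(ℝ, ℂ)} (hΦ : Continuous Φ)
    (hint : ∀ k n, Integrable (fun x ↦ SchwartzMap.seminorm ℂ k n (Φ x)) μ) (k n : ℕ) :
    Integrable (fun x ↦ weightedDeriv k n (Φ x)) μ := by
  refine (hint k n).mono' ((weightedDeriv k n).continuous.comp hΦ).aestronglyMeasurable ?_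
  exact Filter.Eventually.of_forall fun x ↦ (norm_weightedDeriv k n (Φ x)).le

/-- Repeated differentiation under the integral sign, dominated at each order by the integrable
seminorm of index `(0, n + 1)`. -/
theorem derivCLM_pow_eq_integral {Φ : X → 𝓢(ℝ, ℂ)} (hΦ : Continuous Φ)
    (hint : ∀ k n, Integrable (fun x ↦ SchwartzMap.seminorm ℂ k n (Φ x)) μ) {Ψ : 𝓢(ℝ, ℂ)}
    (hΨ : ∀ y, Ψ y = ∫ x, Φ x y ∂μ) (n : ℕ) (y : ℝ) :
    ((derivCLM ℂ ℂ) ^ n) Ψ y = ∫ x, ((derivCLM ℂ ℂ) ^ n) (Φ x) y ∂μ := by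
  have hI : ∀ (n : ℕ) (y : ℝ), Integrable (fun x ↦ ((derivCLM ℂ ℂ) ^ n) (Φ x) y) μ := by
    intro n y
    have := (BoundedContinuousFunction.evalCLM ℂ y).integrable_comp
      (integrable_weightedDeriv hΦ hint 0 n)
    simpa [weightedDeriv_apply] using this
  induction n generalizing y with
  | zero => simpa using hΨ y
  | succ n ih =>
    have hs : ∀ (ψ : 𝓢(ℝ, ℂ)) (y : ℝ),
        ((derivCLM ℂ ℂ) ^ (n + 1)) ψ y = deriv (((derivCLM ℂ ℂ) ^ n) ψ) y := by
      intro ψ y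
      rw [pow_succ', mul_apply_eq_comp, derivCLM_apply]
    have key := hasDerivAt_integral_of_dominated_loc_of_deriv_le (μ := μ)
      (F := fun (y : ℝ) x ↦ ((derivCLM ℂ ℂ) ^ n) (Φ x) y)
      (F' := fun (y : ℝ) x ↦ ((derivCLM ℂ ℂ) ^ (n + 1)) (Φ x) y) (x₀ := y)
      (bound := fun x ↦ SchwartzMap.seminorm ℂ 0 (n + 1) (Φ x)) (s := Set.univ)
      Filter.univ_mem (Filter.Eventually.of_forall fun y ↦ (hI n y).aestronglyMeasurable) (hI n y)
      (hI (n + 1) y).aestronglyMeasurable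
      (Filter.Eventually.of_forall fun x z _ ↦ by
        have := le_seminorm' ℂ 0 (n + 1) (Φ x) z
        rw [derivCLM_pow_apply]
        simpa using this)
      (hint 0 (n + 1))
      (Filter.Eventually.of_forall fun x z _ ↦ by
        rw [hs]
        exact SchwartzMap.hasDerivAt _ z)
    rw [hs, ← key.2.deriv]
    congr 1
    funext z
    exact ih z

/-- A tempered distribution commutes with absolutely convergent integrals of Schwartz functions. -/
theorem integral_distribution {Φ : X → 𝓢(ℝ, ℂ)} (hΦ : Continuous Φ)
    (hint : ∀ k n, Integrable (fun x ↦ SchwartzMap.seminorm ℂ k n (Φ x)) μ) {Ψ : 𝓢(ℝ, ℂ)}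
    (hΨ : ∀ y, Ψ y = ∫ x, Φ x y ∂μ) (u : 𝓢'(ℝ, ℂ)) :
    ∫ x, u (Φ x) ∂μ = u Ψ := by
  obtain ⟨s, L, hL⟩ := exists_eq_weightedDeriv u
  simp_rw [hL]
  -- The Bochner integral is taken in the Banach space of tuples of bounded continuous functions,
  -- where `L` passes through it; the components are then compared pointwise.
  have hI : Integrable (fun x ↦ (fun i : s ↦ weightedDeriv i.1.1 i.1.2 (Φ x))) μ :=
    Integrable.of_eval fun i ↦ integrable_weightedDeriv hΦ hint _ _
  rw [L.integral_comp_comm hI]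
  congr 1
  funext i
  rw [eval_integral fun i ↦ integrable_weightedDeriv hΦ hint _ _]
  ext y
  have := (BoundedContinuousFunction.evalCLM ℂ y).integral_comp_comm
      (integrable_weightedDeriv hΦ hint i.1.1 i.1.2)
  simp only [BoundedContinuousFunction.evalCLM_apply] at this
  rw [← this]
  simp_rw [weightedDeriv_apply]
  rw [integral_const_mul, derivCLM_pow_eq_integral hΦ hint hΨ]

end integral

/-! ### Growth and continuity of time-frequency shifts in the Schwartz space -/

theorem seminorm_succ (k n : ℕ) (ψ : 𝓢(ℝ, ℂ)) :
    SchwartzMap.seminorm ℂ k (n + 1) ψ = SchwartzMap.seminorm ℂ k n (derivCLM ℂ ℂ ψ) := by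
  rw [← norm_weightedDeriv, ← norm_weightedDeriv]
  rfl

theorem exists_one_add_pow_mul_le (φ : 𝓢(ℝ, ℂ)) (k : ℕ) :
    ∃ C, 0 ≤ C ∧ ∀ y, (1 + |y|) ^ k * ‖φ y‖ ≤ C := by
  have h := one_add_le_sup_seminorm_apply (𝕜 := ℂ) (m := (k, 0)) le_rfl le_rfl φ
  simp only [norm_iteratedFDeriv_zero, Real.norm_eq_abs] at h
  exact ⟨_, by positivity, h⟩

theorem norm_conjShift_apply (φ : 𝓢(ℝ, ℂ)) (x ξ t : ℝ) : ‖conjShift φ x ξ t‖ = ‖φ (t - x)‖ := by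
  rw [conjShift_apply, norm_mul, Complex.norm_exp]
  simp

/-- The product rule, in the form that drives the inductions on `n` below: a derivative either falls
on the window or costs a factor `ξ`. -/
theorem derivCLM_conjShift (φ : 𝓢(ℝ, ℂ)) (x ξ : ℝ) :
    derivCLM ℂ ℂ (conjShift φ x ξ) =
      conjShift (derivCLM ℂ ℂ φ) x ξ - (Complex.I * ξ) • conjShift φ x ξ := by
  ext t
  rw [derivCLM_apply, sub_apply, smul_apply, conjShift_apply,
    conjShift_apply, derivCLM_apply]
  have h1 : HasDerivAt (fun t : ℝ ↦ conj (φ (t - x))) (conj (deriv φ (t - x))) t := by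
    have := (SchwartzMap.hasDerivAt φ (t - x)).comp_sub_const t x
    exact this.star
  have h2 : HasDerivAt (fun t : ℝ ↦ -(Complex.I * (t : ℂ) * ξ)) (-(Complex.I * ξ)) t := by
    have := ((((hasDerivAt_id t).ofReal_comp).const_mul Complex.I).mul_const (ξ : ℂ)).neg
    exact this.congr_deriv (by simp)
  have h3 := h1.mul h2.cexp
  have h4 : (conjShift φ x ξ : ℝ → ℂ) =
      fun t ↦ conj (φ (t - x)) * Complex.exp (-(Complex.I * t * ξ)) := by
    funext t
    exact conjShift_apply φ x ξ t
  rw [h4]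
  refine h3.deriv.trans ?_
  simp only [smul_eq_mul]
  ring

theorem abs_pow_le_one_add (k : ℕ) (x y : ℝ) : |y| ^ k ≤ (1 + |x|) ^ k * (1 + |y - x|) ^ k := by
  rw [← mul_pow]
  refine pow_le_pow_left₀ (abs_nonneg _) ?_ k
  have : |y| ≤ |y - x| + |x| := by simpa using abs_add_le (y - x) x
  nlinarith [abs_nonneg x, abs_nonneg (y - x)]

theorem exists_abs_pow_mul_le (φ : 𝓢(ℝ, ℂ)) (k : ℕ) :
    ∃ C, 0 ≤ C ∧ ∀ x y, |y| ^ k * ‖φ (y - x)‖ ≤ C * (1 + |x|) ^ k := by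
  obtain ⟨C, hC0, hC⟩ := exists_one_add_pow_mul_le φ k
  refine ⟨C, hC0, fun x y ↦ ?_⟩
  calc |y| ^ k * ‖φ (y - x)‖ ≤ ((1 + |x|) ^ k * (1 + |y - x|) ^ k) * ‖φ (y - x)‖ := by
        gcongr; exact abs_pow_le_one_add k x y
    _ = (1 + |x|) ^ k * ((1 + |y - x|) ^ k * ‖φ (y - x)‖) := by ring
    _ ≤ (1 + |x|) ^ k * C := by gcongr; exact hC _
    _ = _ := mul_comm _ _

/-- The weight `|y|^k` costs `(1 + |x|)^k`, since `φ` decays around `x`, and each derivative costs a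
factor `1 + |ξ|`. Such polynomial growth is absorbed later by the decay of the ambiguity function.
-/
theorem exists_seminorm_conjShift_le (k n : ℕ) (φ : 𝓢(ℝ, ℂ)) :
    ∃ C, 0 ≤ C ∧ ∀ x ξ, SchwartzMap.seminorm ℂ k n (conjShift φ x ξ) ≤
      C * ((1 + |x|) ^ k * (1 + |ξ|) ^ n) := by
  induction n generalizing φ with
  | zero =>
    obtain ⟨C, hC0, hC⟩ := exists_abs_pow_mul_le φ k
    refine ⟨C, hC0, fun x ξ ↦ seminorm_le_bound' ℂ k 0 _ (by positivity) fun y ↦ ?_⟩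
    simpa [norm_conjShift_apply] using hC x y
  | succ n ih =>
    obtain ⟨C₁, h10, h1⟩ := ih (derivCLM ℂ ℂ φ)
    obtain ⟨C₂, h20, h2⟩ := ih φ
    refine ⟨C₁ + C₂, by positivity, fun x ξ ↦ ?_⟩
    rw [seminorm_succ, derivCLM_conjShift]
    refine (map_sub_le_add _ _ _).trans ?_
    rw [map_smul_eq_mul]
    have h3 : ‖Complex.I * (ξ : ℂ)‖ = |ξ| := by simp
    rw [h3]
    have hA : 0 ≤ (1 + |x|) ^ k * (1 + |ξ|) ^ n := by positivity
    refine (add_le_add (h1 x ξ) (mul_le_mul_of_nonneg_left (h2 x ξ) (abs_nonneg ξ))).trans ?_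
    generalize hAdef : (1 + |x|) ^ k * (1 + |ξ|) ^ n = A at hA ⊢
    have hE : (1 + |x|) ^ k * (1 + |ξ|) ^ (n + 1) = A * (1 + |ξ|) := by rw [← hAdef]; ring
    rw [hE]
    nlinarith [abs_nonneg ξ, mul_nonneg h10 (mul_nonneg hA (abs_nonneg ξ)), mul_nonneg h20 hA]

theorem norm_exp_sub_exp_le (a b : ℝ) :
    ‖Complex.exp (-(Complex.I * a)) - Complex.exp (-(Complex.I * b))‖ ≤ |a - b| := by
  have h : ∀ x ∈ (Set.univ : Set ℝ), HasDerivWithinAt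
      (fun x : ℝ ↦ Complex.exp (-(Complex.I * x)))
      (Complex.exp (-(Complex.I * x)) * (-Complex.I)) Set.univ x := by
    intro x _
    have := (((hasDerivAt_id x).ofReal_comp).const_mul Complex.I).neg.cexp
    rw [hasDerivWithinAt_univ]
    simpa using this
  have := convex_univ.norm_image_sub_le_of_norm_hasDerivWithin_le h (C := 1)
    (fun x _ ↦ by simp [Complex.norm_exp]) (Set.mem_univ b) (Set.mem_univ a)
  simpa using this

/-- A local Lipschitz bound, by the mean value inequality in `x` and in `ξ`. It yields continuity of
the shifts in the Schwartz topology, hence joint continuity of `V_φ u`, from which measurability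
follows later. -/
theorem exists_seminorm_conjShift_sub_le (R : ℝ) (hR : 0 ≤ R) (k n : ℕ) (φ : 𝓢(ℝ, ℂ)) :
    ∃ C, 0 ≤ C ∧ ∀ x x' ξ ξ', |x| ≤ R → |x'| ≤ R → |ξ| ≤ R → |ξ'| ≤ R →
      SchwartzMap.seminorm ℂ k n (conjShift φ x ξ - conjShift φ x' ξ') ≤
        C * (|x - x'| + |ξ - ξ'|) := by
  induction n generalizing φ with
  | zero =>
    obtain ⟨C₁, h10, h1⟩ := exists_abs_pow_mul_le (derivCLM ℂ ℂ φ) k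
    -- One more power of `|y|` is needed because `e^{-iyξ}` has Lipschitz constant `|y|` in `ξ`.
    obtain ⟨C₂, h20, h2⟩ := exists_abs_pow_mul_le φ (k + 1)
    refine ⟨C₁ * (1 + R) ^ k + C₂ * (1 + R) ^ (k + 1), by positivity,
      fun x x' ξ ξ' hx hx' hξ hξ' ↦ seminorm_le_bound' ℂ k 0 _ (by positivity) fun y ↦ ?_⟩
    have hA : |y| ^ k * ‖φ (y - x) - φ (y - x')‖ ≤ C₁ * (1 + R) ^ k * |x - x'| := by
      have hd : ∀ s ∈ Set.Icc (-R) R, HasDerivWithinAt (fun s ↦ ((|y| ^ k : ℝ) : ℂ) * φ (y - s))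
          (((|y| ^ k : ℝ) : ℂ) * (-deriv φ (y - s))) (Set.Icc (-R) R) s := fun s _ ↦
        (((SchwartzMap.hasDerivAt φ (y - s)).comp_const_sub y s).const_mul _).hasDerivWithinAt
      have := (convex_Icc (-R) R).norm_image_sub_le_of_norm_hasDerivWithin_le hd
        (C := C₁ * (1 + R) ^ k) (fun s hs ↦ ?_) (abs_le.1 hx') (abs_le.1 hx)
      · rw [← mul_sub, norm_mul, Complex.norm_real, Real.norm_eq_abs, abs_pow, abs_abs] at this
        simpa using this
      · rw [norm_mul, Complex.norm_real, Real.norm_eq_abs, abs_pow, abs_abs, norm_neg]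
        refine (h1 s y).trans ?_
        gcongr
        exact abs_le.2 hs
    have hB : |y| ^ k * (‖φ (y - x')‖ * (|y| * |ξ - ξ'|)) ≤
        C₂ * (1 + R) ^ (k + 1) * |ξ - ξ'| := by
      calc _ = (|y| ^ (k + 1) * ‖φ (y - x')‖) * |ξ - ξ'| := by ring
        _ ≤ (C₂ * (1 + |x'|) ^ (k + 1)) * |ξ - ξ'| := by exact mul_le_mul_of_nonneg_right (h2 x' y) (abs_nonneg _)
        _ ≤ _ := by gcongr
    rw [iteratedDeriv_zero, sub_apply, conjShift_apply, conjShift_apply]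
    have hE : conj (φ (y - x)) * Complex.exp (-(Complex.I * y * ξ)) -
        conj (φ (y - x')) * Complex.exp (-(Complex.I * y * ξ')) =
        conj (φ (y - x) - φ (y - x')) * Complex.exp (-(Complex.I * y * ξ)) +
        conj (φ (y - x')) * (Complex.exp (-(Complex.I * (y * ξ : ℝ))) -
          Complex.exp (-(Complex.I * (y * ξ' : ℝ)))) := by
      rw [RingHom.map_sub]; push_cast; simp only [mul_assoc]; ring
    have hn : ‖conj (φ (y - x)) * Complex.exp (-(Complex.I * y * ξ)) -
        conj (φ (y - x')) * Complex.exp (-(Complex.I * y * ξ'))‖ ≤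
        ‖φ (y - x) - φ (y - x')‖ + ‖φ (y - x')‖ * (|y| * |ξ - ξ'|) := by
      rw [hE]
      refine (norm_add_le _ _).trans ?_
      gcongr
      · rw [norm_mul, RCLike.norm_conj, Complex.norm_exp]
        simp
      · rw [norm_mul, RCLike.norm_conj]
        gcongr
        refine (norm_exp_sub_exp_le _ _).trans (le_of_eq ?_)
        rw [← mul_sub, abs_mul]
    calc _ ≤ |y| ^ k * (‖φ (y - x) - φ (y - x')‖ + ‖φ (y - x')‖ * (|y| * |ξ - ξ'|)) := by
          gcongr
      _ ≤ C₁ * (1 + R) ^ k * |x - x'| + C₂ * (1 + R) ^ (k + 1) * |ξ - ξ'| := by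
          rw [mul_add]; exact add_le_add hA hB
      _ ≤ _ := by
          have h3 : 0 ≤ C₁ * (1 + R) ^ k * |ξ - ξ'| := by positivity
          have h4 : 0 ≤ C₂ * (1 + R) ^ (k + 1) * |x - x'| := by positivity
          linarith
  | succ n ih =>
    obtain ⟨C₁, h10, h1⟩ := ih (derivCLM ℂ ℂ φ)
    obtain ⟨C₂, h20, h2⟩ := ih φ
    obtain ⟨C₃, h30, h3⟩ := exists_seminorm_conjShift_le k n φ
    refine ⟨C₁ + R * C₂ + C₃ * ((1 + R) ^ k * (1 + R) ^ n), by positivity,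
      fun x x' ξ ξ' hx hx' hξ hξ' ↦ ?_⟩
    rw [seminorm_succ, map_sub, derivCLM_conjShift, derivCLM_conjShift]
    have hE : conjShift (derivCLM ℂ ℂ φ) x ξ - (Complex.I * ξ) • conjShift φ x ξ -
        (conjShift (derivCLM ℂ ℂ φ) x' ξ' - (Complex.I * ξ') • conjShift φ x' ξ') =
        (conjShift (derivCLM ℂ ℂ φ) x ξ - conjShift (derivCLM ℂ ℂ φ) x' ξ') -
        ((Complex.I * ξ) • (conjShift φ x ξ - conjShift φ x' ξ') +
          (Complex.I * ((ξ - ξ' : ℝ) : ℂ)) • conjShift φ x' ξ') := by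
      push_cast
      module
    rw [hE]
    refine (map_sub_le_add _ _ _).trans ?_
    refine (add_le_add le_rfl (map_add_le_add _ _ _)).trans ?_
    rw [map_smul_eq_mul, map_smul_eq_mul, norm_mul, norm_mul, Complex.norm_I, one_mul, one_mul,
      Complex.norm_real, Complex.norm_real, Real.norm_eq_abs, Real.norm_eq_abs]
    have e1 := h1 x x' ξ ξ' hx hx' hξ hξ'
    have e2 : |ξ| * SchwartzMap.seminorm ℂ k n (conjShift φ x ξ - conjShift φ x' ξ') ≤
        R * (C₂ * (|x - x'| + |ξ - ξ'|)) := by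
      gcongr
      exact h2 x x' ξ ξ' hx hx' hξ hξ'
    have e3 : |ξ - ξ'| * SchwartzMap.seminorm ℂ k n (conjShift φ x' ξ') ≤
        (|x - x'| + |ξ - ξ'|) * (C₃ * ((1 + R) ^ k * (1 + R) ^ n)) := by
      gcongr
      · linarith [abs_nonneg (x - x')]
      · refine (h3 x' ξ').trans ?_
        gcongr
    linarith

theorem continuous_conjShift (φ : 𝓢(ℝ, ℂ)) :
    Continuous (fun z : ℝ × ℝ ↦ conjShift φ z.1 z.2) := by
  rw [continuous_iff_continuousAt]
  intro z
  rw [ContinuousAt, (schwartz_withSeminorms ℂ ℝ ℂ).tendsto_nhds _ _]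
  rintro ⟨k, n⟩ ε hε
  obtain ⟨C, hC0, hC⟩ := exists_seminorm_conjShift_sub_le (|z.1| + |z.2| + 1) (by positivity) k n φ
  have hball : ∀ᶠ w in nhds z, dist w z < 1 := Metric.ball_mem_nhds z one_pos
  have hlim : Filter.Tendsto (fun w : ℝ × ℝ ↦ C * (|w.1 - z.1| + |w.2 - z.2|)) (nhds z)
      (nhds 0) := by
    have : Continuous (fun w : ℝ × ℝ ↦ C * (|w.1 - z.1| + |w.2 - z.2|)) := by fun_prop
    simpa using this.tendsto z
  filter_upwards [hball, hlim.eventually_lt_const hε] with w hw hw'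
  rw [Prod.dist_eq, max_lt_iff, Real.dist_eq, Real.dist_eq] at hw
  have a1 := abs_sub_abs_le_abs_sub w.1 z.1
  have a2 := abs_sub_abs_le_abs_sub w.2 z.2
  have b1 := abs_nonneg z.1
  have b2 := abs_nonneg z.2
  refine lt_of_le_of_lt (hC w.1 z.1 w.2 z.2 ?_ ?_ ?_ ?_) hw' <;> linarith

theorem continuous_stft (φ : 𝓢(ℝ, ℂ)) (u : 𝓢'(ℝ, ℂ)) :
    Continuous (fun z : ℝ × ℝ ↦ stft φ u z.1 z.2) :=
  (map_continuous u).comp (continuous_conjShift φ)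

/-! ### The Fourier transform on the Schwartz space in the `e^{-ixξ}` normalisation -/

theorem fourierSchwartz_eq (φ : 𝓢(ℝ, ℂ)) (ξ : ℝ) :
    fourierSchwartz φ ξ = 𝓕 φ ((2 * Real.pi)⁻¹ * ξ) := by
  simp [fourierSchwartz, mul_comm]

theorem fourierSchwartz_fourierSchwartz (φ : 𝓢(ℝ, ℂ)) (t : ℝ) :
    fourierSchwartz (fourierSchwartz φ) t = 2 * Real.pi * φ (-t) := by
  rw [fourierSchwartz_apply]
  simp_rw [fourierSchwartz_eq]
  have hπ : (2 * Real.pi) ≠ 0 := Real.two_pi_pos.ne'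
  have h := Measure.integral_comp_mul_left
    (fun s : ℝ ↦ 𝓕 φ s * Complex.exp (-(Complex.I * ((2 * Real.pi * s : ℝ) : ℂ) * t)))
    (2 * Real.pi)⁻¹
  have h1 : ∀ x : ℝ, 2 * Real.pi * ((2 * Real.pi)⁻¹ * x) = x := fun x ↦ by field_simp
  simp only [h1] at h
  rw [h, inv_inv, abs_of_pos Real.two_pi_pos]
  have h2 : φ (-t) = 𝓕 (𝓕 φ) t := by
    have := congrArg (fun s : 𝓢(ℝ, ℂ) ↦ s (-t)) (fourierInv_apply_eq (𝓕 φ))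
    rw [fourierInv_fourier_eq] at this
    simpa using this
  rw [h2, fourier_coe (𝓕 φ), Real.fourier_real_eq_integral_exp_smul]
  rw [Complex.real_smul]
  push_cast
  congr 1
  refine integral_congr_ae (Filter.Eventually.of_forall fun x ↦ ?_)
  simp only [smul_eq_mul]
  rw [mul_comm]
  congr 2
  ring

theorem fourierSchwartz_derivCLM (φ : 𝓢(ℝ, ℂ)) (ω : ℝ) :
    fourierSchwartz (derivCLM ℂ ℂ φ) ω = Complex.I * ω * fourierSchwartz φ ω := by
  rw [fourierSchwartz_eq, fourierSchwartz_eq, fourier_coe, fourier_coe]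
  have h : ((derivCLM ℂ ℂ φ : 𝓢(ℝ, ℂ)) : ℝ → ℂ) = deriv φ := by
    funext x
    exact derivCLM_apply ..
  rw [h, Real.fourier_deriv φ.integrable φ.differentiable
    (by rw [← h]; exact SchwartzMap.integrable _)]
  simp only [smul_eq_mul]
  push_cast
  have : (Real.pi : ℂ) ≠ 0 := by exact_mod_cast Real.pi_ne_zero
  field_simp

theorem integral_norm_sq_fourierSchwartz (φ : 𝓢(ℝ, ℂ)) :
    ∫ ω, ‖fourierSchwartz φ ω‖ ^ 2 = 2 * Real.pi * ∫ t, ‖φ t‖ ^ 2 := by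
  simp_rw [fourierSchwartz_eq]
  rw [Measure.integral_comp_mul_left (fun s : ℝ ↦ ‖𝓕 φ s‖ ^ 2), inv_inv,
    abs_of_pos Real.two_pi_pos, integral_norm_sq_fourier, smul_eq_mul]

theorem norm_fourierSchwartz_le (φ : 𝓢(ℝ, ℂ)) (ω : ℝ) : ‖fourierSchwartz φ ω‖ ≤ ∫ t, ‖φ t‖ := by
  rw [fourierSchwartz_apply]
  refine (norm_integral_le_integral_norm _).trans (le_of_eq ?_)
  congr 1
  funext t
  rw [norm_mul, Complex.norm_exp]
  simp

/-! ### The cross-ambiguity function and the inversion formula -/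

/-- The pointwise complex conjugate of a Schwartz function. -/
noncomputable def conjSchwartz (ψ : 𝓢(ℝ, ℂ)) : 𝓢(ℝ, ℂ) :=
  ψ.postcompCLM Complex.conjCLE.toContinuousLinearMap

theorem conjSchwartz_apply (ψ : 𝓢(ℝ, ℂ)) (t : ℝ) : conjSchwartz ψ t = conj (ψ t) := by
  simp [conjSchwartz, postcompCLM_apply]

/-- The cross-ambiguity function `∫ ψ(t) γ(t - x) e^{itξ} dt`. -/
noncomputable def ambiguity (ψ γ : 𝓢(ℝ, ℂ)) (x ξ : ℝ) : ℂ :=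
  ∫ t, ψ t * γ (t - x) * Complex.exp (Complex.I * t * ξ)

/-- The Schwartz function `t ↦ ψ(t) γ(t - x)`. -/
noncomputable def shiftMul (ψ γ : 𝓢(ℝ, ℂ)) (x : ℝ) : 𝓢(ℝ, ℂ) :=
  pairing (ContinuousLinearMap.mul ℂ ℂ) ψ (γ.compSubConstCLM ℂ x)

theorem shiftMul_apply (ψ γ : 𝓢(ℝ, ℂ)) (x t : ℝ) : shiftMul ψ γ x t = ψ t * γ (t - x) := by
  simp [shiftMul, pairing_apply_apply]

/-- At fixed `x` the ambiguity function is a Fourier transform, so decay in `ξ` and Fourier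
inversion become available. -/
theorem ambiguity_eq_fourierSchwartz (ψ γ : 𝓢(ℝ, ℂ)) (x ξ : ℝ) :
    ambiguity ψ γ x ξ = fourierSchwartz (shiftMul ψ γ x) (-ξ) := by
  simp [ambiguity, fourierSchwartz_apply, shiftMul_apply]

/-- This reading as a short-time Fourier transform serves to inherit joint continuity from
`continuous_stft`. -/
theorem ambiguity_eq_conj_stft (ψ γ : 𝓢(ℝ, ℂ)) (x ξ : ℝ) :
    ambiguity ψ γ x ξ = conj (stft γ (toTemperedDistributionCLM ℝ ℂ volume (conjSchwartz ψ)) x ξ) := by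
  rw [stft, toTemperedDistributionCLM_apply_apply volume, ← integral_conj, ambiguity]
  congr 1
  funext t
  simp [conjSchwartz_apply, conjShift_apply, ← Complex.exp_conj]
  ring

theorem continuous_ambiguity (ψ γ : 𝓢(ℝ, ℂ)) :
    Continuous (fun z : ℝ × ℝ ↦ ambiguity ψ γ z.1 z.2) := by
  simp_rw [ambiguity_eq_conj_stft]
  exact Complex.continuous_conj.comp (continuous_stft _ _)

/-- A factor `x = t - (t - x)` is absorbed as a weight on `ψ` or on `γ`, and a factor `ξ` as a
derivative of the product `ψ(t) γ(t - x)`. Both produce ambiguity functions of other Schwartz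
functions, so the induction runs over all pairs. -/
theorem exists_norm_ambiguity_le (m n : ℕ) (ψ γ : 𝓢(ℝ, ℂ)) :
    ∃ C, 0 ≤ C ∧ ∀ x ξ, (1 + |x|) ^ m * (1 + |ξ|) ^ n * ‖ambiguity ψ γ x ξ‖ ≤ C := by
  induction n generalizing ψ γ with
  | zero =>
    induction m generalizing ψ γ with
    | zero =>
      refine ⟨SchwartzMap.seminorm ℂ 0 0 γ * ∫ t, ‖ψ t‖, by positivity, fun x ξ ↦ ?_⟩
      rw [ambiguity_eq_fourierSchwartz, pow_zero, pow_zero, one_mul, one_mul]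
      refine (norm_fourierSchwartz_le _ _).trans ?_
      rw [← integral_const_mul]
      refine integral_mono (SchwartzMap.integrable _).norm (ψ.integrable.norm.const_mul _)
        fun t ↦ ?_
      simp only [shiftMul_apply, norm_mul]
      rw [mul_comm]
      gcongr
      exact norm_le_seminorm ℂ γ _
    | succ m ih =>
      obtain ⟨C₁, h10, h1⟩ := ih ψ γ
      obtain ⟨C₂, h20, h2⟩ := ih (smulLeftCLM ℂ (fun y : ℝ ↦ (y : ℂ) ^ 1) ψ) γ
      obtain ⟨C₃, h30, h3⟩ := ih ψ (smulLeftCLM ℂ (fun y : ℝ ↦ (y : ℂ) ^ 1) γ)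
      refine ⟨C₁ + C₂ + C₃, by positivity, fun x ξ ↦ ?_⟩
      have hE : (x : ℂ) * ambiguity ψ γ x ξ =
          ambiguity (smulLeftCLM ℂ (fun y : ℝ ↦ (y : ℂ) ^ 1) ψ) γ x ξ -
          ambiguity ψ (smulLeftCLM ℂ (fun y : ℝ ↦ (y : ℂ) ^ 1) γ) x ξ := by
        simp only [ambiguity_eq_fourierSchwartz]
        rw [← sub_apply, ← map_sub, ← smul_eq_mul, ← smul_apply, ← map_smul]
        congr 2
        ext t
        simp only [smul_apply, sub_apply, shiftMul_apply, smul_eq_mul,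
          smulLeftCLM_apply_apply (hasTemperateGrowth_ofReal_pow 1)]
        push_cast
        ring
      have hn := congrArg norm hE
      rw [norm_mul, Complex.norm_real, Real.norm_eq_abs] at hn
      have hn' := hn.le.trans (norm_sub_le _ _)
      have h1 := h1 x ξ
      have h2 := h2 x ξ
      have h3 := h3 x ξ
      rw [pow_zero, mul_one] at *
      have hA : 0 ≤ (1 + |x|) ^ m := by positivity
      calc _ = (1 + |x|) ^ m * ‖ambiguity ψ γ x ξ‖ +
            (1 + |x|) ^ m * (|x| * ‖ambiguity ψ γ x ξ‖) := by ring
        _ ≤ _ := by linarith [mul_le_mul_of_nonneg_left hn' hA]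
  | succ n ih =>
    obtain ⟨C₁, h10, h1⟩ := ih ψ γ
    obtain ⟨C₂, h20, h2⟩ := ih (derivCLM ℂ ℂ ψ) γ
    obtain ⟨C₃, h30, h3⟩ := ih ψ (derivCLM ℂ ℂ γ)
    refine ⟨C₁ + C₂ + C₃, by positivity, fun x ξ ↦ ?_⟩
    have hE : -(Complex.I * (ξ : ℂ)) * ambiguity ψ γ x ξ =
        ambiguity (derivCLM ℂ ℂ ψ) γ x ξ + ambiguity ψ (derivCLM ℂ ℂ γ) x ξ := by
      simp only [ambiguity_eq_fourierSchwartz]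
      have := fourierSchwartz_derivCLM (shiftMul ψ γ x) (-ξ)
      rw [← add_apply, ← map_add]
      push_cast at this
      rw [mul_neg] at this
      rw [← this]
      congr 2
      ext t
      simp only [add_apply, shiftMul_apply, derivCLM_apply]
      have h4 := (SchwartzMap.hasDerivAt ψ t).mul ((SchwartzMap.hasDerivAt γ (t - x)).comp_sub_const t x)
      have h5 : (shiftMul ψ γ x : ℝ → ℂ) = fun t ↦ ψ t * γ (t - x) := by
        funext t
        exact shiftMul_apply ψ γ x t
      rw [h5]
      exact h4.deriv
    have hn := congrArg norm hE
    rw [norm_mul, norm_neg, norm_mul, Complex.norm_I, one_mul, Complex.norm_real,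
      Real.norm_eq_abs] at hn
    have hn' := hn.le.trans (norm_add_le _ _)
    have h1 := h1 x ξ
    have h2 := h2 x ξ
    have h3 := h3 x ξ
    have hA : 0 ≤ (1 + |x|) ^ m * (1 + |ξ|) ^ n := by positivity
    calc _ = (1 + |x|) ^ m * (1 + |ξ|) ^ n * ‖ambiguity ψ γ x ξ‖ +
          (1 + |x|) ^ m * (1 + |ξ|) ^ n * (|ξ| * ‖ambiguity ψ γ x ξ‖) := by ring
      _ ≤ _ := by linarith [mul_le_mul_of_nonneg_left hn' hA]

/-- Covariance: translating the integration variable by `y` leaves only a unimodular factor. This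
gives the reproducing formula its convolution structure. -/
theorem norm_ambiguity_conjShift (φ γ : 𝓢(ℝ, ℂ)) (y η x ξ : ℝ) :
    ‖ambiguity (conjShift φ y η) γ x ξ‖ = ‖ambiguity (conjSchwartz φ) γ (x - y) (ξ - η)‖ := by
  have h : ambiguity (conjShift φ y η) γ x ξ =
      Complex.exp (Complex.I * ((y * (ξ - η) : ℝ) : ℂ)) *
        ambiguity (conjSchwartz φ) γ (x - y) (ξ - η) := by
    rw [ambiguity, ← integral_add_right_eq_self _ y, ambiguity, ← integral_const_mul]
    congr 1
    funext t
    have hE : Complex.exp (-(Complex.I * (t + y) * η)) * Complex.exp (Complex.I * (t + y) * ξ) =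
        Complex.exp (Complex.I * (y * (ξ - η))) * Complex.exp (Complex.I * t * (ξ - η)) := by
      rw [← Complex.exp_add, ← Complex.exp_add]
      congr 1
      ring
    rw [conjShift_apply, conjSchwartz_apply, add_sub_cancel_right,
      show t + y - x = t - (x - y) by ring]
    push_cast
    linear_combination conj (φ t) * γ (t - (x - y)) * hE
  rw [h, norm_mul, Complex.norm_exp]
  simp

theorem integrable_seminorm_ambiguity_smul_conjShift (φ ψ γ : 𝓢(ℝ, ℂ)) (k n : ℕ) :
    Integrable (fun z : ℝ × ℝ ↦
      SchwartzMap.seminorm ℂ k n (ambiguity ψ γ z.1 z.2 • conjShift φ z.1 z.2)) := by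
  -- `k` and `n` powers cancel the growth of the seminorm; the two extra powers in each variable
  -- leave the integrable `(1 + x²)⁻¹ (1 + ξ²)⁻¹`.
  obtain ⟨C₁, h10, h1⟩ := exists_norm_ambiguity_le (k + 2) (n + 2) ψ γ
  obtain ⟨C₂, h20, h2⟩ := exists_seminorm_conjShift_le k n φ
  have hI := (integrable_inv_one_add_sq.mul_prod integrable_inv_one_add_sq).const_mul (C₁ * C₂)
  refine Integrable.mono' hI ?_ (Filter.Eventually.of_forall fun z ↦ ?_)
  · have hc : Continuous (fun z : ℝ × ℝ ↦ ambiguity ψ γ z.1 z.2 • conjShift φ z.1 z.2) :=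
      (continuous_ambiguity ψ γ).smul (continuous_conjShift φ)
    exact (((schwartz_withSeminorms ℂ ℝ ℂ).continuous_seminorm (k, n)).comp hc).aestronglyMeasurable
  · rw [map_smul_eq_mul, Real.norm_of_nonneg (by positivity)]
    have hsq : ∀ x : ℝ, 1 + x ^ 2 ≤ (1 + |x|) ^ 2 := fun x ↦ by
      nlinarith [abs_nonneg x, sq_abs x]
    have hA : 0 < 1 + z.1 ^ 2 := by positivity
    have hB : 0 < 1 + z.2 ^ 2 := by positivity
    rw [← mul_inv, ← div_eq_mul_inv, le_div_iff₀ (by positivity)]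
    calc _ ≤ ‖ambiguity ψ γ z.1 z.2‖ * (C₂ * ((1 + |z.1|) ^ k * (1 + |z.2|) ^ n)) *
          ((1 + |z.1|) ^ 2 * (1 + |z.2|) ^ 2) := by
          gcongr
          · exact h2 _ _
          · exact hsq _
          · exact hsq _
      _ = ((1 + |z.1|) ^ (k + 2) * (1 + |z.2|) ^ (n + 2) * ‖ambiguity ψ γ z.1 z.2‖) * C₂ := by ring
      _ ≤ _ := by gcongr; exact h1 _ _

/-- Reconstruction of a tempered distribution from its short-time Fourier transform. -/
theorem integral_ambiguity_mul_stft (φ ψ : 𝓢(ℝ, ℂ)) (u : 𝓢'(ℝ, ℂ)) :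
    ∫ z : ℝ × ℝ, ambiguity ψ φ z.1 z.2 * stft φ u z.1 z.2 =
      ((2 * Real.pi * ∫ t, ‖φ t‖ ^ 2 : ℝ) : ℂ) * u ψ := by
  have hc : Continuous (fun z : ℝ × ℝ ↦ ambiguity ψ φ z.1 z.2 • conjShift φ z.1 z.2) :=
    (continuous_ambiguity ψ φ).smul (continuous_conjShift φ)
  have hs := integrable_seminorm_ambiguity_smul_conjShift φ ψ φ
  have key := integral_distribution hc hs
    (Ψ := ((2 * Real.pi * ∫ t, ‖φ t‖ ^ 2 : ℝ) : ℂ) • ψ) (fun y ↦ ?_) u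
  · simpa [stft] using key
  · have hI : Integrable (fun z : ℝ × ℝ ↦ (ambiguity ψ φ z.1 z.2 • conjShift φ z.1 z.2) y) := by
      refine (hs 0 0).mono' ?_ (Filter.Eventually.of_forall fun z ↦ norm_le_seminorm ℂ _ y)
      exact ((SchwartzMap.toBoundedContinuousFunctionCLM ℂ ℝ ℂ).continuous.comp
        hc).eval_const y |>.aestronglyMeasurable
    -- Fourier inversion in `ξ` at fixed `x` returns `2π ψ(y) |φ(y - x)|²`; integrating in `x` then
    -- gives the constant `2π‖φ‖²`.
    have hin : ∀ x : ℝ, ∫ ξ : ℝ, (ambiguity ψ φ x ξ • conjShift φ x ξ) y =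
        (2 * Real.pi * ψ y) * ((‖φ (y - x)‖ ^ 2 : ℝ) : ℂ) := by
      intro x
      have e1 : ∀ ξ : ℝ, (ambiguity ψ φ x ξ • conjShift φ x ξ) y = conj (φ (y - x)) *
          (fourierSchwartz (shiftMul ψ φ x) (-ξ) *
            Complex.exp (-(Complex.I * ((-ξ : ℝ) : ℂ) * ((-y : ℝ) : ℂ)))) := by
        intro ξ
        rw [smul_apply, ambiguity_eq_fourierSchwartz, conjShift_apply, smul_eq_mul]
        push_cast
        rw [show -(Complex.I * (-(ξ : ℂ)) * (-(y : ℂ))) = -(Complex.I * y * ξ) by ring]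
        ring
      simp_rw [e1]
      rw [integral_const_mul, integral_neg_eq_self (fun ξ : ℝ ↦
        fourierSchwartz (shiftMul ψ φ x) ξ * Complex.exp (-(Complex.I * (ξ : ℂ) * ((-y : ℝ) : ℂ)))),
        ← fourierSchwartz_apply, fourierSchwartz_fourierSchwartz, neg_neg, shiftMul_apply,
        ← Complex.normSq_eq_norm_sq, Complex.normSq_eq_conj_mul_self]
      ring
    rw [Measure.volume_eq_prod, integral_prod _ hI]
    simp_rw [hin]
    rw [integral_const_mul, integral_complex_ofReal,
      integral_sub_left_eq_self (fun t ↦ ‖φ t‖ ^ 2), smul_apply]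
    push_cast
    rw [smul_eq_mul]
    ring

/-! ### Minkowski's integral inequality -/

section Minkowski

variable {T Y : Type*} [MeasurableSpace T] [MeasurableSpace Y] {μ : Measure T} {ν : Measure Y}

/-- Hölder applied to `H = (H w^{-1/q'}) · w^{1/q'}`, then Tonelli and the bound on each slice.
Positivity of `w` is what makes the negative powers harmless. -/
theorem lintegral_rpow_lintegral_le [SFinite μ] [SFinite ν] {q : ℝ} (hq : 1 ≤ q)
    {H : T → Y → ℝ≥0∞} (hH : Measurable (Function.uncurry H)) {w : Y → ℝ≥0∞} (hw : Measurable w)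
    (hw0 : ∀ y, w y ≠ 0) (hwtop : ∫⁻ y, w y ∂ν ≠ ∞)
    (hle : ∀ y, ∫⁻ t, H t y ^ q ∂μ ≤ w y ^ q) :
    ∫⁻ t, (∫⁻ y, H t y ∂ν) ^ q ∂μ ≤ (∫⁻ y, w y ∂ν) ^ q := by
  rcases hq.eq_or_lt with rfl | hq
  · simp only [ENNReal.rpow_one] at *
    rw [lintegral_lintegral_swap hH.aemeasurable]
    exact lintegral_mono hle
  have hq0 : 0 < q := by linarith
  have hpq : q.HolderConjugate (Real.conjExponent q) := Real.HolderConjugate.conjExponent hq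
  set q' := Real.conjExponent q with hq'
  have hq'0 : 0 < q' := hpq.symm.pos
  have hww : ∀ᵐ y ∂ν, w y < ∞ := ae_lt_top hw hwtop
  set W := ∫⁻ y, w y ∂ν
  have hs : 1 / q' * q = q - 1 := by
    have := hpq.sub_one_mul_conj
    field_simp
    linarith
  have h1 : ∀ t, (∫⁻ y, H t y ∂ν) ^ q ≤ (∫⁻ y, H t y ^ q * w y ^ (-(q - 1)) ∂ν) * W ^ (q - 1) := by
    intro t
    have hHt : Measurable (H t) := hH.comp measurable_prodMk_left
    have e1 : ∫⁻ y, H t y ∂ν ≤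
        ∫⁻ y, ((fun y ↦ H t y * w y ^ (-(1 / q'))) * fun y ↦ w y ^ (1 / q')) y ∂ν := by
      refine lintegral_mono_ae ?_
      filter_upwards [hww] with y hy
      simp only [Pi.mul_apply]
      rw [mul_assoc, ← ENNReal.rpow_add _ _ (hw0 y) hy.ne]
      simp
    have e2 := e1.trans (ENNReal.lintegral_mul_le_Lp_mul_Lq ν hpq
      (hHt.mul (hw.pow_const _)).aemeasurable (hw.pow_const _).aemeasurable)
    have e3 : ∀ y, (w y ^ (1 / q')) ^ q' = w y := by
      intro y
      rw [← ENNReal.rpow_mul, one_div, inv_mul_cancel₀ hq'0.ne', ENNReal.rpow_one]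
    have e4 : ∀ y, (H t y * w y ^ (-(1 / q'))) ^ q = H t y ^ q * w y ^ (-(q - 1)) := by
      intro y
      rw [ENNReal.mul_rpow_of_nonneg _ _ hq0.le, ← ENNReal.rpow_mul, neg_mul, hs]
    simp only [e3, e4] at e2
    refine (ENNReal.rpow_le_rpow e2 hq0.le).trans (le_of_eq ?_)
    rw [ENNReal.mul_rpow_of_nonneg _ _ hq0.le, ← ENNReal.rpow_mul, ← ENNReal.rpow_mul, hs,
      one_div, inv_mul_cancel₀ hq0.ne', ENNReal.rpow_one]
  have hmeas : Measurable (Function.uncurry fun t y ↦ H t y ^ q * w y ^ (-(q - 1))) :=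
    (hH.pow_const q).mul ((hw.comp measurable_snd).pow_const _)
  calc _ ≤ ∫⁻ t, (∫⁻ y, H t y ^ q * w y ^ (-(q - 1)) ∂ν) * W ^ (q - 1) ∂μ := lintegral_mono h1
    _ = (∫⁻ t, ∫⁻ y, H t y ^ q * w y ^ (-(q - 1)) ∂ν ∂μ) * W ^ (q - 1) :=
        lintegral_mul_const _ hmeas.lintegral_prod_right'
    _ = (∫⁻ y, ∫⁻ t, H t y ^ q * w y ^ (-(q - 1)) ∂μ ∂ν) * W ^ (q - 1) := by
        rw [lintegral_lintegral_swap hmeas.aemeasurable]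
    _ ≤ (∫⁻ y, w y ∂ν) * W ^ (q - 1) := by
        gcongr ?_ * _
        refine lintegral_mono_ae ?_
        filter_upwards [hww] with y hy
        have hHy : Measurable (fun t ↦ H t y) := hH.comp measurable_prodMk_right
        rw [lintegral_mul_const _ (hHy.pow_const q)]
        calc _ ≤ w y ^ q * w y ^ (-(q - 1)) := by gcongr; exact hle y
          _ = w y := by
            rw [← ENNReal.rpow_add _ _ (hw0 y) hy.ne]
            simp
    _ = W ^ q := by
        have := ENNReal.rpow_add_of_nonneg (x := W) 1 (q - 1) zero_le_one (by linarith)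
        rw [ENNReal.rpow_one, add_sub_cancel] at this
        exact this.symm

/-- A qualitative form of Minkowski's integral inequality. -/
theorem lintegral_rpow_lintegral_lt_top [SFinite μ] [SigmaFinite ν] {q : ℝ} (hq : 1 ≤ q)
    {H : T → Y → ℝ≥0∞} (hH : Measurable (Function.uncurry H))
    (hfin : ∫⁻ y, (∫⁻ t, H t y ^ q ∂μ) ^ (1 / q) ∂ν < ∞) :
    ∫⁻ t, (∫⁻ y, H t y ∂ν) ^ q ∂μ < ∞ := by
  have hq0 : 0 < q := by linarith
  -- Adding a strictly positive integrable `g` to the slice norms makes the majorant nonvanishing;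
  -- since only finiteness is claimed, the loss does not matter.
  obtain ⟨g, hg0, hg, hgint⟩ := exists_pos_lintegral_lt_of_sigmaFinite ν (ε := 1) one_ne_zero
  have hm : Measurable fun y ↦ (∫⁻ t, H t y ^ q ∂μ) ^ (1 / q) :=
    (hH.pow_const q).lintegral_prod_left'.pow_const _
  have hw : ∫⁻ y, ((∫⁻ t, H t y ^ q ∂μ) ^ (1 / q) + g y) ∂ν < ∞ := by
    rw [lintegral_add_left hm]
    exact ENNReal.add_lt_top.2 ⟨hfin, hgint.trans ENNReal.one_lt_top⟩
  refine (lintegral_rpow_lintegral_le hq hH (hm.add hg.coe_nnreal_ennreal) (fun y ↦ ?_) hw.ne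
    fun y ↦ ?_).trans_lt (ENNReal.rpow_lt_top_of_nonneg hq0.le hw.ne)
  · simp [(hg0 y).ne']
  · calc _ = ((∫⁻ t, H t y ^ q ∂μ) ^ (1 / q)) ^ q := by
          rw [← ENNReal.rpow_mul, one_div, inv_mul_cancel₀ hq0.ne', ENNReal.rpow_one]
      _ ≤ _ := by gcongr; exact le_self_add

end Minkowski

/-! ### Uniform bounds on the short-time Fourier transform and `M^{p,1} ⊆ M^{2,1}` -/

theorem memLp_of_norm_le_one {f : ℝ → ℝ} (hf : Integrable f) (h1 : ∀ x, ‖f x‖ ≤ 1)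
    (p : ℝ≥0∞) (hp : 1 ≤ p) : MemLp f p := by
  refine ⟨hf.aestronglyMeasurable, ?_⟩
  rcases eq_or_ne p ∞ with rfl | hpt
  · exact (memLp_top_of_bound hf.aestronglyMeasurable 1 (Filter.Eventually.of_forall h1)).2
  rw [eLpNorm_lt_top_iff_lintegral_rpow_enorm_lt_top (zero_lt_one.trans_le hp).ne' hpt]
  refine lt_of_le_of_lt (lintegral_mono fun x ↦ ?_) hf.2
  have h2 : 1 ≤ p.toReal := by
    rw [← ENNReal.toReal_one]
    exact ENNReal.toReal_mono hpt hp
  have h3 : ‖f x‖ₑ ≤ 1 := by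
    rw [← ofReal_norm, ← ENNReal.ofReal_one]
    exact ENNReal.ofReal_le_ofReal (h1 x)
  calc ‖f x‖ₑ ^ p.toReal ≤ ‖f x‖ₑ ^ (1 : ℝ) := ENNReal.rpow_le_rpow_of_exponent_ge h3 h2
    _ = _ := ENNReal.rpow_one _

theorem memLp_inv_one_add_sq (p : ℝ≥0∞) (hp : 1 ≤ p) :
    MemLp (fun x : ℝ ↦ (1 + x ^ 2)⁻¹) p := by
  refine memLp_of_norm_le_one integrable_inv_one_add_sq (fun x ↦ ?_) p hp
  rw [Real.norm_of_nonneg (by positivity)]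
  exact inv_le_one_of_one_le₀ (by nlinarith [sq_nonneg x])

theorem lintegral_enorm_mul_le_eLpNorm_mul_eLpNorm {p q : ℝ≥0∞} [ENNReal.HolderTriple q p 1]
    {f : ℝ → ℂ} {k : ℝ → ℝ} (hf : AEStronglyMeasurable f) (hk : AEStronglyMeasurable k) :
    ∫⁻ x, ‖f x‖ₑ * ‖k x‖ₑ ≤ eLpNorm k q * eLpNorm f p := by
  have h2 := eLpNorm_smul_le_mul_eLpNorm (p := q) (q := p) (r := 1) hf hk
  rw [eLpNorm_one_eq_lintegral_enorm] at h2
  refine le_trans (le_of_eq ?_) h2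
  refine lintegral_congr fun x ↦ ?_
  rw [Pi.smul_apply', enorm_smul, mul_comm]

/-- Hölder's inequality against translates of a function. -/
theorem lintegral_enorm_mul_comp_sub_le {p q : ℝ≥0∞} (hpq : q.HolderConjugate p) {k : ℝ → ℝ}
    (hk : AEStronglyMeasurable k) {f : ℝ → ℂ} (hf : AEStronglyMeasurable f) (y : ℝ) :
    ∫⁻ x, ‖f x‖ₑ * ‖k (x - y)‖ₑ ≤ eLpNorm k q * eLpNorm f p := by
  have hmp := measurePreserving_sub_right (volume : Measure ℝ) y
  have h := eLpNorm_comp_measurePreserving (p := q) hk hmp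
  rw [← h]
  exact lintegral_enorm_mul_le_eLpNorm_mul_eLpNorm hf (hk.comp_measurePreserving hmp)

/-- Hölder with the conjugate exponent `q` (`q = ∞` when `p = 1`): `C` is the `L^q` norm of the
kernel, uniform in `y` by translation invariance. -/
theorem exists_lintegral_mul_inv_one_add_sq_le (p : ℝ≥0∞) [hp : Fact (1 ≤ p)] :
    ∃ C : ℝ≥0∞, C ≠ ∞ ∧ ∀ f : ℝ → ℂ, AEStronglyMeasurable f → ∀ y : ℝ,
      ∫⁻ x, ‖f x‖ₑ * ‖(1 + (x - y) ^ 2)⁻¹‖ₑ ≤ C * eLpNorm f p := by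
  have hpq := (ENNReal.HolderConjugate.inv_one_sub_inv' hp.out).symm
  have hq : 1 ≤ (1 - p⁻¹)⁻¹ := by simp
  generalize (1 - p⁻¹)⁻¹ = q at hq hpq
  have hk := memLp_inv_one_add_sq q hq
  use eLpNorm (fun x : ℝ ↦ (1 + x ^ 2)⁻¹) q
  constructor
  · exact hk.eLpNorm_ne_top
  · intro f hf y
    exact lintegral_enorm_mul_comp_sub_le hpq hk.1 hf y

theorem lintegral_prod_mul_sub_le {F : ℝ × ℝ → ℝ≥0∞} (hF : Measurable F) {m k : ℝ → ℝ≥0∞}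
    (hm : Measurable m) (hk : Measurable k) {C : ℝ≥0∞}
    (h : ∀ ξ y, ∫⁻ x, F (x, ξ) * k (x - y) ≤ C * m ξ) (y η : ℝ) :
    ∫⁻ z : ℝ × ℝ, F z * k (z.1 - y) * k (z.2 - η) ≤ C * ∫⁻ ξ, m ξ * k (ξ - η) := by
  rw [Measure.volume_eq_prod, lintegral_prod_symm' _ (by fun_prop),
    ← lintegral_const_mul _ (by fun_prop)]
  refine lintegral_mono fun ξ ↦ ?_
  simp only
  rw [lintegral_mul_const _ (by fun_prop), ← mul_assoc]
  gcongr
  exact h ξ y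

theorem lintegral_lintegral_mul_sub {m k : ℝ → ℝ≥0∞} (hm : Measurable m) (hk : Measurable k) :
    ∫⁻ η, ∫⁻ ξ, m ξ * k (ξ - η) = (∫⁻ ξ, m ξ) * ∫⁻ x, k x := by
  rw [lintegral_lintegral_swap (by fun_prop)]
  have h : ∀ ξ, ∫⁻ η, m ξ * k (ξ - η) = m ξ * ∫⁻ x, k x := by
    intro ξ
    rw [lintegral_const_mul _ (by fun_prop), lintegral_sub_left_eq_self k]
  simp_rw [h]
  rw [lintegral_mul_const _ hm]

/-- From `|f|² ≤ M^{2-p} |f|^p` one gets `‖f‖₂² ≤ M^{2-p} ‖f‖_p^p ≤ (M + ‖f‖_p)²`. The additive form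
can be integrated in `ξ` term by term. -/
theorem eLpNorm_two_le_add {f : ℝ → ℂ} (hf : Measurable fun x ↦ ‖f x‖ₑ) {p M : ℝ≥0∞}
    (hp0 : p ≠ 0) (hp : p ≤ 2) (hM : ∀ x, ‖f x‖ₑ ≤ M) :
    eLpNorm f 2 ≤ M + eLpNorm f p := by
  have hpt : p ≠ ∞ := (hp.trans_lt ENNReal.ofNat_lt_top).ne
  have hq0 : 0 < p.toReal := ENNReal.toReal_pos hp0 hpt
  have hq2 : 0 ≤ 2 - p.toReal := by
    have := ENNReal.toReal_mono ENNReal.ofNat_ne_top hp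
    simpa using this
  have hp2 : (2 : ℝ≥0∞).toReal = 2 := by simp
  rw [eLpNorm_eq_lintegral_rpow_enorm_toReal two_ne_zero ENNReal.ofNat_ne_top, hp2, one_div,
    ENNReal.rpow_inv_le_iff two_pos]
  have hsum : ∀ s : ℝ≥0∞, s ^ (2 - p.toReal) * s ^ p.toReal = s ^ (2 : ℝ) := by
    intro s
    rw [← ENNReal.rpow_add_of_nonneg _ _ hq2 hq0.le, sub_add_cancel]
  have hpow : ∫⁻ x, ‖f x‖ₑ ^ p.toReal = eLpNorm f p ^ p.toReal := by
    rw [eLpNorm_eq_lintegral_rpow_enorm_toReal hp0 hpt, ← ENNReal.rpow_mul, one_div,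
      inv_mul_cancel₀ hq0.ne', ENNReal.rpow_one]
  have h1 : ∫⁻ x, ‖f x‖ₑ ^ (2 : ℝ) ≤ ∫⁻ x, M ^ (2 - p.toReal) * ‖f x‖ₑ ^ p.toReal := by
    refine lintegral_mono fun x ↦ ?_
    change ‖f x‖ₑ ^ (2 : ℝ) ≤ M ^ (2 - p.toReal) * ‖f x‖ₑ ^ p.toReal
    rw [← hsum]
    exact mul_le_mul_left (ENNReal.rpow_le_rpow (hM x) hq2) _
  rw [lintegral_const_mul _ (hf.pow_const _), hpow] at h1
  generalize eLpNorm f p = N at h1 ⊢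
  refine h1.trans ?_
  rw [← hsum (M + N)]
  exact mul_le_mul' (ENNReal.rpow_le_rpow le_self_add hq2)
    (ENNReal.rpow_le_rpow le_add_self hq0.le)

theorem modulationENorm_one (φ : 𝓢(ℝ, ℂ)) (p : ℝ≥0∞) (u : 𝓢'(ℝ, ℂ)) :
    modulationENorm φ p 1 u = ∫⁻ ξ, eLpNorm (fun x : ℝ ↦ stft φ u x ξ) p volume := by
  rw [modulationENorm, eLpNorm_one_eq_lintegral_enorm]
  rfl

theorem exists_enorm_ambiguity_le (ψ γ : 𝓢(ℝ, ℂ)) :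
    ∃ C : ℝ≥0∞, C ≠ ∞ ∧ ∀ x ξ, ‖ambiguity ψ γ x ξ‖ₑ ≤
      C * (‖(1 + x ^ 2)⁻¹‖ₑ * ‖(1 + ξ ^ 2)⁻¹‖ₑ) := by
  obtain ⟨C, hC0, hC⟩ := exists_norm_ambiguity_le 2 2 ψ γ
  refine ⟨ENNReal.ofReal C, ENNReal.ofReal_ne_top, fun x ξ ↦ ?_⟩
  rw [← enorm_mul, ← ofReal_norm, ← ofReal_norm, ← ENNReal.ofReal_mul hC0]
  refine ENNReal.ofReal_le_ofReal ?_
  rw [Real.norm_of_nonneg (by positivity), ← mul_inv, ← div_eq_mul_inv, le_div_iff₀ (by positivity)]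
  have hsq : ∀ x : ℝ, 1 + x ^ 2 ≤ (1 + |x|) ^ 2 := fun x ↦ by
    nlinarith [abs_nonneg x, sq_abs x]
  refine le_trans ?_ (hC x ξ)
  rw [mul_comm]
  gcongr
  · exact hsq _
  · exact hsq _

theorem integral_norm_sq_pos {φ : 𝓢(ℝ, ℂ)} (hφ : φ ≠ 0) : 0 < ∫ t, ‖φ t‖ ^ 2 := by
  have hint : Integrable (fun t ↦ ‖φ t‖ ^ 2) :=
    (memLp_two_iff_integrable_sq_norm φ.continuous.aestronglyMeasurable).1 (φ.memLp 2)
  have hc : Continuous (fun t ↦ ‖φ t‖ ^ 2) := by fun_prop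
  obtain ⟨t, ht⟩ : ∃ t, φ t ≠ 0 := by
    by_contra! h
    exact hφ (SchwartzMap.ext h)
  exact integral_pos_of_integrable_nonneg_nonzero hc hint (fun t ↦ by positivity) (x := t)
    (by simpa using ht)

theorem measurable_eLpNorm_stft (φ : 𝓢(ℝ, ℂ)) (p : ℝ≥0∞) (hp0 : p ≠ 0) (hp : p ≠ ∞)
    (u : 𝓢'(ℝ, ℂ)) : Measurable (fun ξ ↦ eLpNorm (fun x : ℝ ↦ stft φ u x ξ) p volume) := by
  simp_rw [eLpNorm_eq_lintegral_rpow_enorm_toReal hp0 hp]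
  exact ((continuous_stft φ u).enorm.measurable.pow_const _).lintegral_prod_left'.pow_const _

/-- Essentially `M^{p,1} ⊆ M^{∞,1}`. The reproducing formula bounds `|V_φ u|` by a convolution with
a product kernel; Hölder in `x` leaves the convolution in `ξ` of an integrable function with `(1 +
ξ²)⁻¹`. -/
theorem exists_enorm_stft_le {φ : 𝓢(ℝ, ℂ)} (hφ : φ ≠ 0) {p : ℝ≥0∞} [hp1 : Fact (1 ≤ p)]
    (hp : p ≠ ∞) {u : 𝓢'(ℝ, ℂ)} (hu : u ∈ modulationSpace φ p 1) :
    ∃ M : ℝ → ℝ≥0∞, Measurable M ∧ (∀ x ξ, ‖stft φ u x ξ‖ₑ ≤ M ξ) ∧ ∫⁻ ξ, M ξ < ∞ := by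
  have hm := measurable_eLpNorm_stft φ p (zero_lt_one.trans_le hp1.out).ne' hp u
  have hint : ∫⁻ ξ, eLpNorm (fun x : ℝ ↦ stft φ u x ξ) p volume < ∞ := by
    rw [← modulationENorm_one]
    exact hu
  set m := fun ξ ↦ eLpNorm (fun x : ℝ ↦ stft φ u x ξ) p volume
  obtain ⟨C₁, h1top, h1⟩ := exists_enorm_ambiguity_le (conjSchwartz φ) φ
  obtain ⟨C₂, h2top, h2⟩ := exists_lintegral_mul_inv_one_add_sq_le p
  set c : ℂ := ((2 * Real.pi * ∫ t, ‖φ t‖ ^ 2 : ℝ) : ℂ)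
  have hc : c ≠ 0 := by
    simp only [c, Complex.ofReal_ne_zero]
    exact (mul_pos Real.two_pi_pos (integral_norm_sq_pos hφ)).ne'
  set k : ℝ → ℝ≥0∞ := fun x ↦ ‖(1 + x ^ 2)⁻¹‖ₑ with hkdef
  have hkm : Measurable k := by fun_prop
  have hk : ∫⁻ x : ℝ, k x < ∞ := integrable_inv_one_add_sq.2
  have hF : Continuous (fun z : ℝ × ℝ ↦ stft φ u z.1 z.2) := continuous_stft φ u
  have h2' : ∀ ξ y, ∫⁻ x, ‖stft φ u x ξ‖ₑ * k (x - y) ≤ C₂ * m ξ := fun ξ y ↦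
    h2 _ (hF.comp (Continuous.prodMk_left ξ)).aestronglyMeasurable y
  have hMm : Measurable (fun η ↦ ∫⁻ ξ, m ξ * k (ξ - η)) := by
    have : Measurable (fun z : ℝ × ℝ ↦ m z.2 * k (z.2 - z.1)) :=
      (hm.comp measurable_snd).mul (hkm.comp (measurable_snd.sub measurable_fst))
    exact this.lintegral_prod_right'
  refine ⟨fun η ↦ ‖c‖ₑ⁻¹ * (C₁ * (C₂ * ∫⁻ ξ, m ξ * k (ξ - η))), ?_, ?_, ?_⟩
  · exact ((hMm.const_mul _).const_mul _).const_mul _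
  · intro y η
    -- With this test function the right-hand side `u ψ` is `V_φ u (y, η)` itself.
    have key := integral_ambiguity_mul_stft φ (conjShift φ y η) u
    have h3 : ‖c‖ₑ * ‖stft φ u y η‖ₑ ≤ C₁ * (C₂ * ∫⁻ ξ, m ξ * k (ξ - η)) := by
      rw [← enorm_mul, stft, ← key]
      refine (enorm_integral_le_lintegral_enorm _).trans ?_
      refine le_trans ?_ (mul_le_mul_right
        (lintegral_prod_mul_sub_le hF.enorm.measurable hm hkm h2' y η) C₁)
      rw [← lintegral_const_mul' _ _ h1top]
      refine lintegral_mono fun z ↦ ?_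
      simp only
      have h4 : ‖ambiguity (conjShift φ y η) φ z.1 z.2‖ₑ =
          ‖ambiguity (conjSchwartz φ) φ (z.1 - y) (z.2 - η)‖ₑ := by
        rw [← ofReal_norm, ← ofReal_norm, norm_ambiguity_conjShift]
      rw [enorm_mul, h4]
      refine (mul_le_mul_left (h1 _ _) _).trans (le_of_eq ?_)
      ring
    have hc0 : ‖c‖ₑ ≠ 0 := by simpa using hc
    change _ ≤ ‖c‖ₑ⁻¹ * _
    rw [← ENNReal.div_eq_inv_mul, ENNReal.le_div_iff_mul_le (Or.inl hc0)
      (Or.inl enorm_ne_top), mul_comm]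
    exact h3
  · rw [lintegral_const_mul _ ((hMm.const_mul _).const_mul _),
      lintegral_const_mul _ (hMm.const_mul _), lintegral_const_mul _ hMm,
      lintegral_lintegral_mul_sub hm hkm]
    refine ENNReal.mul_lt_top ?_ (ENNReal.mul_lt_top h1top.lt_top
      (ENNReal.mul_lt_top h2top.lt_top (ENNReal.mul_lt_top hint hk)))
    simpa using hc

theorem modulationSpace_subset_two {φ : 𝓢(ℝ, ℂ)} (hφ : φ ≠ 0) {p : ℝ≥0∞} [hp1 : Fact (1 ≤ p)]
    (hp : p ≤ 2) : modulationSpace φ p 1 ⊆ modulationSpace φ 2 1 := by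
  intro u hu
  have hpt : p ≠ ∞ := (hp.trans_lt ENNReal.ofNat_lt_top).ne
  have hp0 : p ≠ 0 := (zero_lt_one.trans_le hp1.out).ne'
  obtain ⟨M, hM, hle, hMint⟩ := exists_enorm_stft_le hφ hpt hu
  have hu' : ∫⁻ ξ, eLpNorm (fun x : ℝ ↦ stft φ u x ξ) p volume < ∞ := by
    rw [← modulationENorm_one]
    exact hu
  change modulationENorm φ 2 1 u < ∞
  rw [modulationENorm_one]
  refine lt_of_le_of_lt (lintegral_mono fun ξ ↦ eLpNorm_two_le_add ?_ hp0 hp fun x ↦ hle x ξ) ?_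
  · exact ((continuous_stft φ u).comp (Continuous.prodMk_left ξ)).enorm.measurable
  · rw [lintegral_add_left hM]
    exact ENNReal.add_lt_top.2 ⟨hMint, hu'⟩

/-! ### Synthesis: elements of `M^{p,1}` are `L^p` functions -/

theorem norm_exp_I_mul (t ξ : ℝ) : ‖Complex.exp (Complex.I * t * ξ)‖ = 1 := by
  rw [Complex.norm_exp]
  simp

theorem eLpNorm_lt_top_of_enorm_le {f : ℝ → ℂ} {G : ℝ → ℝ≥0∞} {p : ℝ≥0∞} (hp0 : p ≠ 0)
    (hp : p ≠ ∞) (h : ∀ t, ‖f t‖ₑ ≤ G t) (hG : ∫⁻ t, G t ^ p.toReal < ∞) : eLpNorm f p < ∞ := by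
  rw [eLpNorm_lt_top_iff_lintegral_rpow_enorm_lt_top hp0 hp]
  refine lt_of_le_of_lt (lintegral_mono fun t ↦ ?_) hG
  exact ENNReal.rpow_le_rpow (h t) ENNReal.toReal_nonneg

/-- The function synthesised from the values `F` with the window `φ`. -/
noncomputable def synthesis (φ : 𝓢(ℝ, ℂ)) (F : ℝ × ℝ → ℂ) (t : ℝ) : ℂ :=
  ∫ z : ℝ × ℝ, φ (t - z.1) * Complex.exp (Complex.I * t * z.2) * F z

theorem continuous_synthesis_kernel (φ : 𝓢(ℝ, ℂ)) {F : ℝ × ℝ → ℂ} (hF : Continuous F) :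
    Continuous (fun w : (ℝ × ℝ) × ℝ ↦
      φ (w.2 - w.1.1) * Complex.exp (Complex.I * w.2 * w.1.2) * F w.1) := by
  have := φ.continuous
  fun_prop

theorem aestronglyMeasurable_synthesis (φ : 𝓢(ℝ, ℂ)) {F : ℝ × ℝ → ℂ} (hF : Continuous F) :
    AEStronglyMeasurable (synthesis φ F) := by
  have : StronglyMeasurable (Function.uncurry fun (t : ℝ) (z : ℝ × ℝ) ↦
      φ (t - z.1) * Complex.exp (Complex.I * t * z.2) * F z) :=
    ((continuous_synthesis_kernel φ hF).comp continuous_swap).stronglyMeasurable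
  exact this.integral_prod_right.aestronglyMeasurable

/-- Substituting `x ↦ t - x` puts `t` into `F`, so Minkowski's inequality sees translates of `F(·,
ξ)`, whose `L^p` norms do not depend on `x`. -/
theorem enorm_synthesis_le (φ : 𝓢(ℝ, ℂ)) {F : ℝ × ℝ → ℂ} (hF : Continuous F) (t : ℝ) :
    ‖synthesis φ F t‖ₑ ≤ ∫⁻ z : ℝ × ℝ, ‖φ z.1‖ₑ * ‖F (t - z.1, z.2)‖ₑ := by
  have hφ := φ.continuous
  refine (enorm_integral_le_lintegral_enorm _).trans (le_of_eq ?_)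
  have h1 : ∀ z : ℝ × ℝ, ‖φ (t - z.1) * Complex.exp (Complex.I * t * z.2) * F z‖ₑ =
      ‖φ (t - z.1)‖ₑ * ‖F (z.1, z.2)‖ₑ := by
    intro z
    rw [enorm_mul, enorm_mul, ← ofReal_norm (Complex.exp _), norm_exp_I_mul, ENNReal.ofReal_one,
      mul_one]
  simp_rw [h1]
  rw [Measure.volume_eq_prod, lintegral_prod_symm' _ (by fun_prop),
    lintegral_prod_symm' _ (by fun_prop)]
  refine lintegral_congr fun ξ ↦ ?_
  rw [← lintegral_sub_left_eq_self (fun x ↦ ‖φ x‖ₑ * ‖F (t - x, ξ)‖ₑ) t]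
  simp only [sub_sub_cancel]

theorem eLpNorm_synthesis_lt_top (φ : 𝓢(ℝ, ℂ)) {F : ℝ × ℝ → ℂ} (hF : Continuous F) {p : ℝ≥0∞}
    (hp1 : 1 ≤ p) (hp : p ≠ ∞) (hint : ∫⁻ ξ, eLpNorm (fun x ↦ F (x, ξ)) p < ∞) :
    eLpNorm (synthesis φ F) p < ∞ := by
  have hp0 : p ≠ 0 := (zero_lt_one.trans_le hp1).ne'
  have hq1 : 1 ≤ p.toReal := by
    rw [← ENNReal.toReal_one]
    exact ENNReal.toReal_mono hp hp1
  have hq0 : 0 < p.toReal := by linarith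
  have hφ := φ.continuous
  refine eLpNorm_lt_top_of_enorm_le hp0 hp (enorm_synthesis_le φ hF)
    (lintegral_rpow_lintegral_lt_top hq1 ?_ ?_)
  · have h1 : Measurable (fun w : ℝ × (ℝ × ℝ) ↦ ‖φ w.2.1‖ₑ) := Continuous.measurable (by fun_prop)
    have h2 : Measurable (fun w : ℝ × (ℝ × ℝ) ↦ ‖F (w.1 - w.2.1, w.2.2)‖ₑ) :=
      Continuous.measurable (by fun_prop)
    exact h1.mul h2
  · have h1 : ∀ z : ℝ × ℝ, (∫⁻ t, (‖φ z.1‖ₑ * ‖F (t - z.1, z.2)‖ₑ) ^ p.toReal) ^ (1 / p.toReal) =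
        ‖φ z.1‖ₑ * eLpNorm (fun x ↦ F (x, z.2)) p := by
      intro z
      have hm : Measurable (fun t ↦ ‖F (t - z.1, z.2)‖ₑ ^ p.toReal) :=
        (Continuous.measurable (by fun_prop)).pow_const _
      simp_rw [ENNReal.mul_rpow_of_nonneg _ _ hq0.le]
      rw [lintegral_const_mul _ hm, ENNReal.mul_rpow_of_nonneg _ _ (by positivity),
        ← ENNReal.rpow_mul, mul_one_div_cancel hq0.ne', ENNReal.rpow_one,
        eLpNorm_eq_lintegral_rpow_enorm_toReal hp0 hp,
        lintegral_sub_right_eq_self (fun x ↦ ‖F (x, z.2)‖ₑ ^ p.toReal)]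
    simp_rw [h1]
    have hm : Measurable (fun ξ ↦ eLpNorm (fun x ↦ F (x, ξ)) p) := by
      simp_rw [eLpNorm_eq_lintegral_rpow_enorm_toReal hp0 hp]
      exact (hF.enorm.measurable.pow_const _).lintegral_prod_left'.pow_const _
    rw [Measure.volume_eq_prod, lintegral_prod_mul (f := fun x ↦ ‖φ x‖ₑ) (by fun_prop) hm.aemeasurable]
    exact ENNReal.mul_lt_top φ.integrable.2 hint

/-- Fubini; the triple integral converges absolutely because `ψ`, `φ` and the majorant `M` take care
of `t`, `x` and `ξ` respectively. -/
theorem integral_mul_synthesis (φ ψ : 𝓢(ℝ, ℂ)) {F : ℝ × ℝ → ℂ} (hF : Continuous F)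
    {M : ℝ → ℝ≥0∞} (hM : Measurable M) (hle : ∀ z, ‖F z‖ₑ ≤ M z.2) (hint : ∫⁻ ξ, M ξ < ∞) :
    ∫ t, ψ t * synthesis φ F t = ∫ z : ℝ × ℝ, ambiguity ψ φ z.1 z.2 * F z := by
  have hψ := ψ.continuous
  have hφ := φ.continuous
  have hK : Continuous (fun w : (ℝ × ℝ) × ℝ ↦
      ψ w.2 * (φ (w.2 - w.1.1) * Complex.exp (Complex.I * w.2 * w.1.2) * F w.1)) := by
    fun_prop
  have hI : Integrable (Function.uncurry fun (z : ℝ × ℝ) (t : ℝ) ↦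
      ψ t * (φ (t - z.1) * Complex.exp (Complex.I * t * z.2) * F z)) := by
    refine ⟨hK.aestronglyMeasurable, ?_⟩
    have hm : Measurable (fun w : (ℝ × ℝ) × ℝ ↦ ‖ψ w.2‖ₑ * (‖φ (w.2 - w.1.1)‖ₑ * M w.1.2)) := by
      have h1 : Measurable (fun w : (ℝ × ℝ) × ℝ ↦ ‖ψ w.2‖ₑ) := Continuous.measurable (by fun_prop)
      have h2 : Measurable (fun w : (ℝ × ℝ) × ℝ ↦ ‖φ (w.2 - w.1.1)‖ₑ) :=
        Continuous.measurable (by fun_prop)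
      exact h1.mul (h2.mul (hM.comp measurable_fst.snd))
    refine lt_of_le_of_lt (lintegral_mono (g := fun w : (ℝ × ℝ) × ℝ ↦
      ‖ψ w.2‖ₑ * (‖φ (w.2 - w.1.1)‖ₑ * M w.1.2)) fun w ↦ ?_) ?_
    · simp only [Function.uncurry]
      rw [enorm_mul, enorm_mul, enorm_mul, ← ofReal_norm (Complex.exp _), norm_exp_I_mul,
        ENNReal.ofReal_one, mul_one]
      gcongr
      exact hle _
    · rw [Measure.volume_eq_prod, lintegral_prod_symm' _ hm]
      have h3 : ∀ t, ∫⁻ z : ℝ × ℝ, ‖ψ t‖ₑ * (‖φ (t - z.1)‖ₑ * M z.2) =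
          ‖ψ t‖ₑ * ((∫⁻ x, ‖φ x‖ₑ) * ∫⁻ ξ, M ξ) := by
        intro t
        have h4 : Measurable (fun z : ℝ × ℝ ↦ ‖φ (t - z.1)‖ₑ * M z.2) :=
          (Continuous.measurable (by fun_prop)).mul (hM.comp measurable_snd)
        rw [lintegral_const_mul _ h4, Measure.volume_eq_prod,
          lintegral_prod_mul (f := fun x ↦ ‖φ (t - x)‖ₑ) (by fun_prop) hM.aemeasurable,
          lintegral_sub_left_eq_self (fun x ↦ ‖φ x‖ₑ)]
      simp_rw [h3]
      rw [lintegral_mul_const _ (by fun_prop)]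
      exact ENNReal.mul_lt_top ψ.integrable.2 (ENNReal.mul_lt_top φ.integrable.2 hint)
  simp_rw [synthesis, ← integral_const_mul]
  rw [← integral_integral_swap hI]
  refine integral_congr_ae (Filter.Eventually.of_forall fun z ↦ ?_)
  simp only
  rw [ambiguity, ← integral_mul_const]
  refine integral_congr_ae (Filter.Eventually.of_forall fun t ↦ ?_)
  simp only
  ring

/-- Elements of `M^{p,1}` are functions in `L^p`. -/
theorem exists_toTemperedDistribution_eq {φ : 𝓢(ℝ, ℂ)} (hφ : φ ≠ 0) {p : ℝ≥0∞}
    [hp1 : Fact (1 ≤ p)] (hp : p ≠ ∞) {u : 𝓢'(ℝ, ℂ)} (hu : u ∈ modulationSpace φ p 1) :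
    ∃ f : Lp ℂ p (volume : Measure ℝ), Lp.toTemperedDistribution f = u := by
  obtain ⟨M, hM, hle, hMint⟩ := exists_enorm_stft_le hφ hp hu
  have hF := continuous_stft φ u
  have hu' : ∫⁻ ξ, eLpNorm (fun x : ℝ ↦ stft φ u x ξ) p volume < ∞ := by
    rw [← modulationENorm_one]
    exact hu
  have hmem : MemLp (synthesis φ fun z ↦ stft φ u z.1 z.2) p :=
    ⟨aestronglyMeasurable_synthesis φ hF, eLpNorm_synthesis_lt_top φ hF hp1.out hp hu'⟩
  set c : ℂ := ((2 * Real.pi * ∫ t, ‖φ t‖ ^ 2 : ℝ) : ℂ)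
  have hc : c ≠ 0 := by
    simp only [c, Complex.ofReal_ne_zero]
    exact (mul_pos Real.two_pi_pos (integral_norm_sq_pos hφ)).ne'
  refine ⟨c⁻¹ • hmem.toLp _, ?_⟩
  ext ψ
  rw [Lp.toTemperedDistribution_apply]
  have h1 : ∫ t, ψ t • (c⁻¹ • hmem.toLp _ : Lp ℂ p (volume : Measure ℝ)) t =
      c⁻¹ * ∫ t, ψ t * synthesis φ (fun z ↦ stft φ u z.1 z.2) t := by
    rw [← integral_const_mul]
    refine integral_congr_ae ?_
    filter_upwards [Lp.coeFn_smul c⁻¹ (hmem.toLp _), hmem.coeFn_toLp] with t h2 h3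
    rw [h2, Pi.smul_apply, h3, smul_eq_mul, smul_eq_mul]
    ring
  rw [h1, integral_mul_synthesis φ ψ hF hM (fun z ↦ hle z.1 z.2) hMint,
    integral_ambiguity_mul_stft, inv_mul_cancel_left₀ hc]

/-! ### Plancherel, the amalgam space `W(L², ℓ¹)` and the inclusion in `FA_p` -/

theorem ae_eq_zero_of_integral_schwartz_eq_zero {h : ℝ → ℂ} (hh : LocallyIntegrable h)
    (h0 : ∀ ψ : 𝓢(ℝ, ℂ), ∫ t, ψ t * h t = 0) : ∀ᵐ t, h t = 0 := by
  refine ae_eq_zero_of_integral_contDiff_smul_eq_zero hh fun g g_smooth g_cpt ↦ ?_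
  have hg₁ : HasCompactSupport (Complex.ofRealCLM ∘ g) := g_cpt.comp_left rfl
  have hg₂ : ContDiff ℝ ((⊤ : ℕ∞) : WithTop ℕ∞) (Complex.ofRealCLM ∘ g) :=
    Complex.ofRealCLM.contDiff.comp g_smooth
  simpa using h0 (hg₁.toSchwartzMap hg₂)

theorem norm_exp_neg_I_mul (t ξ : ℝ) : ‖Complex.exp (-(Complex.I * t * ξ))‖ = 1 := by
  rw [Complex.norm_exp]
  simp

/-- The Fourier integral `∫ g(t) e^{-itξ} dt` of a function. -/
noncomputable def fourierFun (g : ℝ → ℂ) (ξ : ℝ) : ℂ :=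
  ∫ t, g t * Complex.exp (-(Complex.I * t * ξ))

theorem continuous_fourierFun {g : ℝ → ℂ} (hg : Integrable g) : Continuous (fourierFun g) := by
  refine continuous_of_dominated (bound := fun t ↦ ‖g t‖) (fun ξ ↦ ?_) (fun ξ ↦ ?_) hg.norm ?_
  · exact hg.aestronglyMeasurable.mul (Continuous.aestronglyMeasurable (by fun_prop))
  · refine Filter.Eventually.of_forall fun t ↦ ?_
    rw [norm_mul, norm_exp_neg_I_mul, mul_one]
  · refine Filter.Eventually.of_forall fun t ↦ ?_
    fun_prop

theorem norm_fourierFun_le (g : ℝ → ℂ) (ξ : ℝ) : ‖fourierFun g ξ‖ ≤ ∫ t, ‖g t‖ := by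
  refine (norm_integral_le_integral_norm _).trans (le_of_eq ?_)
  simp_rw [norm_mul, norm_exp_neg_I_mul, mul_one]

theorem integral_fourierSchwartz_mul {g : ℝ → ℂ} (hg : Integrable g) (ψ : 𝓢(ℝ, ℂ)) :
    ∫ t, fourierSchwartz ψ t * g t = ∫ ξ, ψ ξ * fourierFun g ξ := by
  have hI : Integrable (Function.uncurry fun (t ξ : ℝ) ↦
      ψ ξ * Complex.exp (-(Complex.I * ξ * t)) * g t) := by
    have h1 : Integrable (fun z : ℝ × ℝ ↦ g z.1 * ψ z.2) := hg.mul_prod ψ.integrable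
    have h2 : Integrable (fun z : ℝ × ℝ ↦ Complex.exp (-(Complex.I * z.2 * z.1)) *
        (g z.1 * ψ z.2)) := by
      refine h1.mono ((Continuous.aestronglyMeasurable (by fun_prop)).mul
        h1.aestronglyMeasurable) (Filter.Eventually.of_forall fun z ↦ ?_)
      rw [norm_mul, norm_exp_neg_I_mul, one_mul]
    refine h2.congr (Filter.Eventually.of_forall fun z ↦ ?_)
    simp only [Function.uncurry]
    ring
  simp_rw [fourierSchwartz_apply, fourierFun, ← integral_const_mul, ← integral_mul_const]
  rw [integral_integral_swap hI]
  refine integral_congr_ae (Filter.Eventually.of_forall fun ξ ↦ ?_)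
  simp only
  refine integral_congr_ae (Filter.Eventually.of_forall fun t ↦ ?_)
  simp only
  rw [show Complex.I * (t : ℂ) * ξ = Complex.I * ξ * t by ring]
  ring

/-- With the dilation performed before `𝓕` instead of after it, `𝓕` can be moved onto the
distribution by duality. -/
theorem fourierSchwartz_eq_fourier_dilation (ψ : 𝓢(ℝ, ℂ)) :
    fourierSchwartz ψ = 𝓕 (((2 * Real.pi : ℝ) : ℂ) • compCLMOfContinuousLinearEquiv ℂ
      (ContinuousLinearEquiv.unitsEquivAut ℝ (Units.mk0 (2 * Real.pi) Real.two_pi_pos.ne')) ψ) := by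
  ext ξ
  rw [fourierSchwartz_apply, fourier_coe, Real.fourier_real_eq_integral_exp_smul]
  have h := Measure.integral_comp_mul_left
    (fun t : ℝ ↦ ψ t * Complex.exp (-(Complex.I * t * ξ))) (2 * Real.pi)
  rw [eq_comm, abs_of_pos (inv_pos.2 Real.two_pi_pos), inv_smul_eq_iff₀ Real.two_pi_pos.ne'] at h
  rw [h, ← integral_smul]
  refine integral_congr_ae (Filter.Eventually.of_forall fun t ↦ ?_)
  simp only [smul_apply, compCLMOfContinuousLinearEquiv_apply, Function.comp_apply,
    ContinuousLinearEquiv.unitsEquivAut_apply, Units.val_mk0, smul_eq_mul, Complex.real_smul]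
  have hE : Complex.exp (-(Complex.I * ((t * (2 * Real.pi) : ℝ) : ℂ) * ξ)) =
      Complex.exp (((-2 * Real.pi * t * ξ : ℝ) : ℂ) * Complex.I) := by
    congr 1
    push_cast
    ring
  rw [mul_comm (2 * Real.pi) t, hE]
  ring

theorem eLpNorm_comp_mul_left {h : ℝ → ℂ} (hh : StronglyMeasurable h) {a : ℝ} (ha : a ≠ 0) :
    eLpNorm (fun x ↦ h (a * x)) 2 volume =
      ENNReal.ofReal |a⁻¹| ^ (1 / (2 : ℝ≥0∞)).toReal * eLpNorm h 2 volume := by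
  have h1 := eLpNorm_map_measure (p := 2) (μ := volume) (f := fun x : ℝ ↦ a * x)
    (hh.aestronglyMeasurable (μ := Measure.map (fun x : ℝ ↦ a * x) volume))
    (measurable_const_mul a).aemeasurable
  rw [Real.map_volume_mul_left ha, eLpNorm_smul_measure_of_ne_top ENNReal.ofNat_ne_top] at h1
  exact h1.symm

/-- `g` is the unitary transform `𝓕 f` dilated by `(2π)⁻¹`, so the constant is `√(2π)`; only its
being nonzero and finite matters. -/
theorem exists_fourierDistribution_eq_L2 :
    ∃ C : ℝ≥0∞, C ≠ 0 ∧ C ≠ ∞ ∧ ∀ f : Lp ℂ 2 (volume : Measure ℝ),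
      ∃ g : Lp ℂ 2 (volume : Measure ℝ),
        fourierDistribution (Lp.toTemperedDistribution f) = Lp.toTemperedDistribution g ∧
        eLpNorm g 2 volume = C * eLpNorm f 2 volume := by
  have hπ : (2 * Real.pi)⁻¹ ≠ 0 := inv_ne_zero Real.two_pi_pos.ne'
  refine ⟨ENNReal.ofReal |(2 * Real.pi)⁻¹⁻¹| ^ (1 / (2 : ℝ≥0∞)).toReal, ?_, ?_, fun f ↦ ?_⟩
  · have : 0 < |(2 * Real.pi)⁻¹⁻¹| := by positivity
    exact (ENNReal.rpow_pos (ENNReal.ofReal_pos.2 this) ENNReal.ofReal_ne_top).ne'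
  · exact ENNReal.rpow_ne_top_of_nonneg ENNReal.toReal_nonneg ENNReal.ofReal_ne_top
  set h : Lp ℂ 2 (volume : Measure ℝ) := 𝓕 f
  have hh := Lp.stronglyMeasurable h
  have hnorm : eLpNorm h 2 volume = eLpNorm f 2 volume := by
    have := Lp.norm_fourier_eq f
    rwa [Lp.norm_def, Lp.norm_def, ENNReal.toReal_eq_toReal_iff' (Lp.eLpNorm_ne_top _)
      (Lp.eLpNorm_ne_top _)] at this
  have hd := eLpNorm_comp_mul_left hh hπ
  have hmem : MemLp (fun ω ↦ h ((2 * Real.pi)⁻¹ * ω)) 2 volume := by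
    refine ⟨(hh.comp_measurable (measurable_const_mul _)).aestronglyMeasurable, ?_⟩
    rw [hd]
    exact ENNReal.mul_lt_top (ENNReal.rpow_lt_top_of_nonneg ENNReal.toReal_nonneg
      ENNReal.ofReal_ne_top) (Lp.eLpNorm_lt_top h)
  refine ⟨hmem.toLp _, ?_, ?_⟩
  · ext ψ
    rw [fourierDistribution_apply, fourierSchwartz_eq_fourier_dilation,
      ← TemperedDistribution.fourier_apply, Lp.fourier_toTemperedDistribution_eq,
      Lp.toTemperedDistribution_apply, Lp.toTemperedDistribution_apply]
    have e1 : ∫ ω, ψ ω • (hmem.toLp _ : Lp ℂ 2 (volume : Measure ℝ)) ω =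
        ∫ ω, ψ ω * h ((2 * Real.pi)⁻¹ * ω) := by
      refine integral_congr_ae ?_
      filter_upwards [hmem.coeFn_toLp] with ω hω
      rw [hω, smul_eq_mul]
    have e2 := Measure.integral_comp_mul_left
      (fun ω : ℝ ↦ ψ ω * h ((2 * Real.pi)⁻¹ * ω)) (2 * Real.pi)
    rw [eq_comm, abs_of_pos (inv_pos.2 Real.two_pi_pos), inv_smul_eq_iff₀ Real.two_pi_pos.ne'] at e2
    rw [e1, e2, ← integral_smul]
    refine integral_congr_ae (Filter.Eventually.of_forall fun t ↦ ?_)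
    simp only [smul_apply, compCLMOfContinuousLinearEquiv_apply, Function.comp_apply,
      ContinuousLinearEquiv.unitsEquivAut_apply, Units.val_mk0, smul_eq_mul, Complex.real_smul]
    rw [inv_mul_cancel_left₀ Real.two_pi_pos.ne', mul_comm (2 * Real.pi) t]
    ring
  · rw [eLpNorm_congr_ae hmem.coeFn_toLp, hd, hnorm]

/-- Plancherel's theorem for functions in `L¹ ∩ L²`. -/
theorem exists_eLpNorm_fourierFun :
    ∃ C : ℝ≥0∞, C ≠ 0 ∧ C ≠ ∞ ∧ ∀ G : ℝ → ℂ, Integrable G → MemLp G 2 →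
      eLpNorm (fourierFun G) 2 volume = C * eLpNorm G 2 volume := by
  obtain ⟨C, hC0, hCt, hC⟩ := exists_fourierDistribution_eq_L2
  refine ⟨C, hC0, hCt, fun G hG1 hG2 ↦ ?_⟩
  obtain ⟨g, hg, hgn⟩ := hC (hG2.toLp G)
  rw [← eLpNorm_congr_ae hG2.coeFn_toLp, ← hgn]
  refine eLpNorm_congr_ae ?_
  have hcont := continuous_fourierFun hG1
  have hint2 : ∀ ψ : 𝓢(ℝ, ℂ), Integrable (fun t ↦ ψ t * g t) := fun ψ ↦
    (ψ.memLp 2).integrable_mul (Lp.memLp g)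
  have hint1 : ∀ ψ : 𝓢(ℝ, ℂ), Integrable (fun t ↦ ψ t * fourierFun G t) := fun ψ ↦
    ψ.integrable.mul_bdd hcont.aestronglyMeasurable
      (Filter.Eventually.of_forall (norm_fourierFun_le G))
  -- The Fourier integral of `G` and its `L²` Fourier transform `g` pair equally with every Schwartz
  -- function, hence agree almost everywhere.
  have key := ae_eq_zero_of_integral_schwartz_eq_zero (h := fun t ↦ fourierFun G t - g t)
    (hcont.locallyIntegrable.sub ((Lp.memLp g).locallyIntegrable one_le_two)) fun ψ ↦ by
      simp_rw [mul_sub]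
      rw [integral_sub (hint1 ψ) (hint2 ψ), ← integral_fourierSchwartz_mul hG1, sub_eq_zero]
      have h1 := DFunLike.congr_fun hg ψ
      rw [fourierDistribution_apply, Lp.toTemperedDistribution_apply,
        Lp.toTemperedDistribution_apply] at h1
      simp only [smul_eq_mul] at h1
      rw [← h1]
      refine integral_congr_ae ?_
      filter_upwards [hG2.coeFn_toLp] with t ht
      rw [ht]
  filter_upwards [key] with t ht
  exact sub_eq_zero.1 ht

theorem fourierSchwartz_ne_zero {φ : 𝓢(ℝ, ℂ)} (hφ : φ ≠ 0) : fourierSchwartz φ ≠ 0 := by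
  intro h
  apply hφ
  ext t
  have h1 := fourierSchwartz_fourierSchwartz φ (-t)
  rw [h, map_zero, neg_neg] at h1
  have hπ : (2 * (Real.pi : ℂ)) ≠ 0 := by exact_mod_cast Real.two_pi_pos.ne'
  simpa [hπ] using h1.symm

/-- The Fourier transform exchanges time and frequency shifts up to a phase. Thus `V_φ u (x, ξ)` is,
up to a phase and `2π`, `û` tested on a shift of `φ̂` by `(ξ, -x)`. -/
theorem fourierSchwartz_conjShift (φ : 𝓢(ℝ, ℂ)) (x ξ : ℝ) :
    fourierSchwartz (conjShift (fourierSchwartz φ) ξ (-x)) =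
      (2 * Real.pi * Complex.exp (Complex.I * x * ξ)) • conjShift φ x ξ := by
  ext t
  rw [fourierSchwartz_apply, ← integral_add_right_eq_self _ ξ, smul_apply, conjShift_apply,
    smul_eq_mul]
  have h1 : ∀ η : ℝ, conjShift (fourierSchwartz φ) ξ (-x) (η + ξ) *
      Complex.exp (-(Complex.I * ((η + ξ : ℝ) : ℂ) * t)) =
      Complex.exp (Complex.I * ξ * (x - t)) *
        conj (fourierSchwartz φ η * Complex.exp (-(Complex.I * η * ((x - t : ℝ) : ℂ)))) := by
    intro η
    have hE : Complex.exp (-(Complex.I * (η + ξ) * (-x))) * Complex.exp (-(Complex.I * (η + ξ) * t)) =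
        Complex.exp (Complex.I * ξ * (x - t)) * Complex.exp (Complex.I * η * (x - t)) := by
      rw [← Complex.exp_add, ← Complex.exp_add]
      congr 1
      ring
    rw [conjShift_apply, add_sub_cancel_right, map_mul, ← Complex.exp_conj]
    simp only [map_neg, map_mul, Complex.conj_I, Complex.conj_ofReal]
    rw [show -(-Complex.I * (η : ℂ) * ((x - t : ℝ) : ℂ)) = Complex.I * η * (x - t) by
      push_cast; ring]
    push_cast
    linear_combination conj (fourierSchwartz φ η) * hE
  simp_rw [h1]
  rw [integral_const_mul, integral_conj, ← fourierSchwartz_apply, fourierSchwartz_fourierSchwartz,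
    neg_sub, map_mul, map_mul, Complex.conj_ofReal, map_ofNat]
  have hE : Complex.exp (Complex.I * ξ * (x - t)) =
      Complex.exp (Complex.I * x * ξ) * Complex.exp (-(Complex.I * t * ξ)) := by
    rw [← Complex.exp_add]
    congr 1
    ring
  rw [hE]
  ring

theorem memLp_mul_conj_schwartz {g : ℝ → ℂ} (hg : MemLp g 2) (ψ : 𝓢(ℝ, ℂ)) (ξ : ℝ) :
    Integrable (fun ω ↦ g ω * conj (ψ (ω - ξ))) ∧
      MemLp (fun ω ↦ g ω * conj (ψ (ω - ξ))) 2 := by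
  have h : (fun ω ↦ conj (ψ (ω - ξ))) = conjShift ψ ξ 0 := by
    funext ω
    simp [conjShift_apply]
  have h1 : (fun ω ↦ g ω * conj (ψ (ω - ξ))) = fun ω ↦ g ω * conjShift ψ ξ 0 ω := by
    funext ω
    exact congrArg _ (congrFun h ω)
  rw [h1]
  exact ⟨hg.integrable_mul ((conjShift ψ ξ 0).memLp 2),
    ((conjShift ψ ξ 0).memLp_top volume).mul' hg⟩

/-- At fixed `ξ`, `2π V_φ u(·, ξ)` has the modulus of the reflected Fourier transform of `û · conj
φ̂(· - ξ)`; Plancherel compares the `L²` norms. -/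
theorem exists_eLpNorm_mul_conj_fourier_le :
    ∃ C : ℝ≥0∞, C ≠ ∞ ∧ ∀ (φ : 𝓢(ℝ, ℂ)) (u : 𝓢'(ℝ, ℂ)) (g : ℝ → ℂ), MemLp g 2 →
      (∀ ψ : 𝓢(ℝ, ℂ), fourierDistribution u ψ = ∫ ω, ψ ω * g ω) → ∀ ξ,
      eLpNorm (fun ω ↦ g ω * conj (fourierSchwartz φ (ω - ξ))) 2 volume ≤
        C * eLpNorm (fun x ↦ stft φ u x ξ) 2 volume := by
  obtain ⟨C, hC0, hCt, hC⟩ := exists_eLpNorm_fourierFun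
  refine ⟨C⁻¹ * ‖(2 * Real.pi : ℝ)‖ₑ, ENNReal.mul_ne_top (ENNReal.inv_ne_top.2 hC0) enorm_ne_top,
    fun φ u g hg hu ξ ↦ ?_⟩
  obtain ⟨hG1, hG2⟩ := memLp_mul_conj_schwartz hg (fourierSchwartz φ) ξ
  set G := fun ω ↦ g ω * conj (fourierSchwartz φ (ω - ξ))
  have h1 := hC G hG1 hG2
  have h2 : ∀ x, ‖fourierFun G (-x)‖ = ‖(2 * Real.pi : ℝ) • stft φ u x ξ‖ := by
    intro x
    have h3 := hu (conjShift (fourierSchwartz φ) ξ (-x))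
    rw [fourierDistribution_apply, fourierSchwartz_conjShift, map_smul] at h3
    have h4 : fourierFun G (-x) = ∫ ω, conjShift (fourierSchwartz φ) ξ (-x) ω * g ω := by
      refine integral_congr_ae (Filter.Eventually.of_forall fun ω ↦ ?_)
      simp only [G, conjShift_apply]
      ring
    rw [h4, ← h3, stft, norm_smul, norm_smul, norm_mul, norm_exp_I_mul, mul_one]
    simp [abs_of_pos Real.pi_pos]
  have h3 : eLpNorm (fourierFun G) 2 volume =
      ‖(2 * Real.pi : ℝ)‖ₑ * eLpNorm (fun x ↦ stft φ u x ξ) 2 volume := by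
    rw [← eLpNorm_const_smul, ← eLpNorm_comp_measurePreserving
      (continuous_fourierFun hG1).aestronglyMeasurable (Measure.measurePreserving_neg volume)]
    exact eLpNorm_congr_norm_ae (Filter.Eventually.of_forall h2)
  rw [mul_assoc, ← h3, h1, ← mul_assoc, ENNReal.inv_mul_cancel hC0 hCt, one_mul]

/-- If `u ∈ M^{2,1}`, then the Fourier transform of `u` is in the amalgam space `W(L², ℓ¹)`. -/
theorem lintegral_eLpNorm_mul_conj_fourier_lt_top {φ : 𝓢(ℝ, ℂ)} {u : 𝓢'(ℝ, ℂ)}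
    (hu : u ∈ modulationSpace φ 2 1) {g : ℝ → ℂ} (hg : MemLp g 2)
    (hug : ∀ ψ : 𝓢(ℝ, ℂ), fourierDistribution u ψ = ∫ ω, ψ ω * g ω) :
    ∫⁻ ξ, eLpNorm (fun ω ↦ g ω * conj (fourierSchwartz φ (ω - ξ))) 2 volume < ∞ := by
  obtain ⟨C, hCt, hC⟩ := exists_eLpNorm_mul_conj_fourier_le
  refine lt_of_le_of_lt (lintegral_mono fun ξ ↦ hC φ u g hg hug ξ) ?_
  rw [lintegral_const_mul' _ _ hCt, ← modulationENorm_one]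
  exact ENNReal.mul_lt_top hCt.lt_top hu

/-- `W(L², ℓ¹) ⊆ L¹`: a second factor `|ψ(ω - ξ)|` and Cauchy–Schwarz give a finite integral of
`|g(ω)| |ψ(ω - ξ)|²` over both variables. By Tonelli this equals `‖g‖₁ ‖ψ‖₂²`, and `‖ψ‖₂ ≠ 0`. -/
theorem integrable_of_lintegral_eLpNorm_lt_top {ψ : 𝓢(ℝ, ℂ)} (hψ : ψ ≠ 0) {g : ℝ → ℂ}
    (hg : StronglyMeasurable g)
    (h : ∫⁻ ξ, eLpNorm (fun ω ↦ g ω * conj (ψ (ω - ξ))) 2 volume < ∞) : Integrable g := by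
  refine ⟨hg.aestronglyMeasurable, ?_⟩
  have hψc := ψ.continuous
  set k : ℝ → ℝ := fun ω ↦ ‖ψ ω‖
  have hk : AEStronglyMeasurable k := hψc.norm.aestronglyMeasurable
  have hA0 : ∫⁻ ω, ‖ψ ω‖ₑ * ‖ψ ω‖ₑ ≠ 0 := by
    intro h0
    have hm : Measurable fun ω ↦ ‖ψ ω‖ₑ := Continuous.measurable (by fun_prop)
    rw [lintegral_eq_zero_iff (by fun_prop)] at h0
    have h1 : (fun ω ↦ ψ ω) =ᵐ[volume] fun _ ↦ 0 := by
      filter_upwards [h0] with ω hω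
      simpa using hω
    have h2 := (hψc.ae_eq_iff_eq volume continuous_const).1 h1
    exact hψ (SchwartzMap.ext fun ω ↦ congrFun h2 ω)
  have hHolder : (2 : ℝ≥0∞).HolderConjugate 2 := inferInstance
  have h1 : ∫⁻ ξ, ∫⁻ ω, ‖g ω‖ₑ * (‖ψ (ω - ξ)‖ₑ * ‖ψ (ω - ξ)‖ₑ) < ∞ := by
    have hlt := ENNReal.mul_lt_top (ψ.memLp 2 volume).2 h
    rw [← lintegral_const_mul' _ _ (ψ.memLp 2 volume).2.ne] at hlt
    refine lt_of_le_of_lt (lintegral_mono fun ξ ↦ ?_) hlt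
    have hG : AEStronglyMeasurable (fun ω ↦ g ω * conj (ψ (ω - ξ))) :=
      hg.aestronglyMeasurable.mul (Continuous.aestronglyMeasurable (by fun_prop))
    have h2 := lintegral_enorm_mul_comp_sub_le hHolder hk hG ξ
    rw [eLpNorm_norm] at h2
    refine le_trans (le_of_eq (lintegral_congr fun ω ↦ ?_)) h2
    rw [enorm_mul, enorm_norm, mul_assoc]
    congr 2
    rw [← ofReal_norm, ← ofReal_norm, RCLike.norm_conj]
  have hm : Measurable (fun z : ℝ × ℝ ↦ ‖g z.2‖ₑ * (‖ψ (z.2 - z.1)‖ₑ * ‖ψ (z.2 - z.1)‖ₑ)) := by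
    have h2 : Measurable (fun z : ℝ × ℝ ↦ ‖ψ (z.2 - z.1)‖ₑ) := Continuous.measurable (by fun_prop)
    exact (hg.enorm.comp measurable_snd).mul (h2.mul h2)
  rw [lintegral_lintegral_swap hm.aemeasurable] at h1
  have h2 : ∀ ω, ∫⁻ ξ, ‖g ω‖ₑ * (‖ψ (ω - ξ)‖ₑ * ‖ψ (ω - ξ)‖ₑ) =
      ‖g ω‖ₑ * ∫⁻ ω, ‖ψ ω‖ₑ * ‖ψ ω‖ₑ := by
    intro ω
    rw [lintegral_const_mul' _ _ enorm_ne_top,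
      lintegral_sub_left_eq_self (fun x ↦ ‖ψ x‖ₑ * ‖ψ x‖ₑ)]
  simp_rw [h2] at h1
  rw [lintegral_mul_const _ hg.enorm] at h1
  exact ENNReal.lt_top_of_mul_ne_top_left h1.ne hA0

/-- `M^{p,1} ⊆ FA_p`. -/
theorem modulationSpace_subset_fourierSegalAlgebra {φ : 𝓢(ℝ, ℂ)} (hφ : φ ≠ 0) {p : ℝ≥0∞}
    [hp1 : Fact (1 ≤ p)] (hp : p ≤ 2) :
    modulationSpace φ p 1 ⊆ fourierSegalAlgebra p := by
  intro u hu
  have hpt : p ≠ ∞ := (hp.trans_lt ENNReal.ofNat_lt_top).ne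
  have hu2 := modulationSpace_subset_two hφ hp hu
  refine ENNReal.add_lt_top.2 ⟨(lpENorm_lt_top_iff p u).2
    (exists_toTemperedDistribution_eq hφ hpt hu), (lpENorm_lt_top_iff 1 _).2 ?_⟩
  obtain ⟨f, hf⟩ := exists_toTemperedDistribution_eq hφ ENNReal.ofNat_ne_top hu2
  obtain ⟨C, -, -, hC⟩ := exists_fourierDistribution_eq_L2
  obtain ⟨g, hg, -⟩ := hC f
  rw [hf] at hg
  have hint := lintegral_eLpNorm_mul_conj_fourier_lt_top hu2 (Lp.memLp g) fun ψ ↦ by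
    rw [hg, Lp.toTemperedDistribution_apply]
    rfl
  have hgi := memLp_one_iff_integrable.2 (integrable_of_lintegral_eLpNorm_lt_top
    (fourierSchwartz_ne_zero hφ) (Lp.stronglyMeasurable g) hint)
  refine ⟨hgi.toLp g, ?_⟩
  ext ψ
  rw [hg, Lp.toTemperedDistribution_apply, Lp.toTemperedDistribution_apply]
  refine integral_congr_ae ?_
  filter_upwards [hgi.coeFn_toLp] with t ht
  rw [ht]

/-! ### Mollification and density -/

/-- The translate `t ↦ f (r + t)` in `L^p`. -/
noncomputable def translateLp {p : ℝ≥0∞} (f : Lp ℂ p (volume : Measure ℝ)) (r : ℝ) :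
    Lp ℂ p (volume : Measure ℝ) := DomAddAct.mk r +ᵥ f

theorem coeFn_translateLp {p : ℝ≥0∞} (f : Lp ℂ p (volume : Measure ℝ)) (r : ℝ) :
    translateLp f r =ᵐ[volume] fun t ↦ f (r + t) := DomAddAct.vadd_Lp_ae_eq _ _

theorem norm_translateLp {p : ℝ≥0∞} (f : Lp ℂ p (volume : Measure ℝ)) (r : ℝ) :
    ‖translateLp f r‖ = ‖f‖ := DomAddAct.norm_vadd_Lp _ _

theorem translateLp_zero {p : ℝ≥0∞} (f : Lp ℂ p (volume : Measure ℝ)) : translateLp f 0 = f := by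
  rw [translateLp, DomAddAct.mk_zero, zero_vadd]

theorem continuous_translateLp {p : ℝ≥0∞} [Fact (1 ≤ p)] (hp : p ≠ ∞)
    (f : Lp ℂ p (volume : Measure ℝ)) : Continuous (translateLp f) := by
  have : Fact (p ≠ ∞) := ⟨hp⟩
  exact (DomAddAct.continuous_mk).vadd continuous_const

/-- The mollification `∫ η(r) f(r + ·) dr` of an element of `L^p`. -/
noncomputable def mollify {p : ℝ≥0∞} [Fact (1 ≤ p)] (η : 𝓢(ℝ, ℂ))
    (f : Lp ℂ p (volume : Measure ℝ)) : Lp ℂ p (volume : Measure ℝ) :=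
  ∫ r, η r • translateLp f r

theorem integrable_smul_translateLp {p : ℝ≥0∞} [Fact (1 ≤ p)] (hp : p ≠ ∞) (η : 𝓢(ℝ, ℂ))
    (f : Lp ℂ p (volume : Measure ℝ)) (δ : ℝ) :
    Integrable (fun r ↦ η r • translateLp f (δ * r)) := by
  refine Integrable.mono' (η.integrable.norm.mul_const ‖f‖) ?_
    (Filter.Eventually.of_forall fun r ↦ ?_)
  · exact (η.continuous.smul ((continuous_translateLp hp f).comp
      (continuous_const_mul δ))).aestronglyMeasurable
  · rw [norm_smul, norm_translateLp]

theorem toTemperedDistribution_translateLp {p : ℝ≥0∞} [Fact (1 ≤ p)]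
    (f : Lp ℂ p (volume : Measure ℝ)) (r : ℝ) (ψ : 𝓢(ℝ, ℂ)) :
    Lp.toTemperedDistribution (translateLp f r) ψ =
      Lp.toTemperedDistribution f (ψ.compSubConstCLM ℂ r) := by
  rw [Lp.toTemperedDistribution_apply, Lp.toTemperedDistribution_apply]
  rw [← integral_add_left_eq_self (fun t ↦ (ψ.compSubConstCLM ℂ r) t • f t) r]
  refine integral_congr_ae ?_
  filter_upwards [coeFn_translateLp f r] with t ht
  rw [ht, compSubConstCLM_apply, add_sub_cancel_left]

/-- Pairing with `ψ` is a continuous functional on `L^p`, so it passes through the Bochner integral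
defining `mollify`. -/
theorem toTemperedDistribution_mollify {p : ℝ≥0∞} [Fact (1 ≤ p)] (hp : p ≠ ∞) (η : 𝓢(ℝ, ℂ))
    (f : Lp ℂ p (volume : Measure ℝ)) (ψ : 𝓢(ℝ, ℂ)) :
    Lp.toTemperedDistribution (mollify η f) ψ =
      ∫ r, η r * Lp.toTemperedDistribution f (ψ.compSubConstCLM ℂ r) := by
  let E : Lp ℂ p (volume : Measure ℝ) →L[ℂ] ℂ :=
    { toFun := fun h ↦ Lp.toTemperedDistributionCLM ℂ volume p h ψ
      map_add' := fun a b ↦ by rw [map_add]; rfl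
      map_smul' := fun a b ↦ by rw [map_smul]; rfl
      cont := (PointwiseConvergenceCLM.evalCLM (RingHom.id ℂ) ℂ ψ).continuous.comp
        (Lp.toTemperedDistributionCLM ℂ volume p).continuous }
  have hI := integrable_smul_translateLp hp η f 1
  simp only [one_mul] at hI
  have h := E.integral_comp_comm hI
  change _ = Lp.toTemperedDistribution (mollify η f) ψ at h
  rw [← h]
  refine integral_congr_ae (Filter.Eventually.of_forall fun r ↦ ?_)
  change E (η r • translateLp f r) = η r * _
  rw [map_smul, smul_eq_mul, ← toTemperedDistribution_translateLp]
  rfl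

/-- The reflected conjugate `t ↦ conj (φ (-t))` of a Schwartz function. -/
noncomputable def reflectConj (φ : 𝓢(ℝ, ℂ)) : 𝓢(ℝ, ℂ) :=
  compCLMOfContinuousLinearEquiv ℂ (ContinuousLinearEquiv.neg ℝ) (conjSchwartz φ)

theorem reflectConj_apply (φ : 𝓢(ℝ, ℂ)) (t : ℝ) : reflectConj φ t = conj (φ (-t)) := by
  simp [reflectConj, conjSchwartz_apply]

/-- Convolving a time-frequency shift with `η` gives an ambiguity function up to a phase, hence
decay in `s - x` and in `ξ` at once. -/
theorem norm_integral_conjShift_sub (η φ : 𝓢(ℝ, ℂ)) (x ξ s : ℝ) :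
    ‖∫ r, η r * conjShift φ x ξ (s - r)‖ = ‖ambiguity η (reflectConj φ) (s - x) ξ‖ := by
  have h : ∫ r, η r * conjShift φ x ξ (s - r) =
      Complex.exp (-(Complex.I * s * ξ)) * ambiguity η (reflectConj φ) (s - x) ξ := by
    rw [ambiguity, ← integral_const_mul]
    refine integral_congr_ae (Filter.Eventually.of_forall fun r ↦ ?_)
    simp only
    rw [conjShift_apply, reflectConj_apply, show -(r - (s - x)) = s - r - x by ring,
      show -(Complex.I * ((s - r : ℝ) : ℂ) * ξ) =
        -(Complex.I * s * ξ) + Complex.I * r * ξ by push_cast; ring, Complex.exp_add]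
    ring
  rw [h, norm_mul, norm_exp_neg_I_mul, one_mul]

theorem integrable_prod_schwartz_mul_Lp {p : ℝ≥0∞} [hp1 : Fact (1 ≤ p)] (η ψ : 𝓢(ℝ, ℂ))
    (f : Lp ℂ p (volume : Measure ℝ)) :
    Integrable (Function.uncurry fun r s : ℝ ↦ η r * (ψ (s - r) * f s)) := by
  have hη := η.continuous
  have hψ := ψ.continuous
  have hf := Lp.stronglyMeasurable f
  have hpq := (ENNReal.HolderConjugate.inv_one_sub_inv' hp1.out).symm
  generalize (1 - p⁻¹)⁻¹ = q at hpq
  have hm : StronglyMeasurable (Function.uncurry fun r s : ℝ ↦ η r * (ψ (s - r) * f s)) := by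
    have h1 : StronglyMeasurable fun z : ℝ × ℝ ↦ η z.1 := Continuous.stronglyMeasurable (by fun_prop)
    have h2 : StronglyMeasurable fun z : ℝ × ℝ ↦ ψ (z.2 - z.1) :=
      Continuous.stronglyMeasurable (by fun_prop)
    exact h1.mul (h2.mul (hf.comp_measurable measurable_snd))
  refine ⟨hm.aestronglyMeasurable, ?_⟩
  obtain ⟨D, hDt, hD⟩ : ∃ D : ℝ≥0∞, D < ∞ ∧ ∀ r, ∫⁻ s, ‖ψ (s - r) * f s‖ₑ ≤ D := by
    refine ⟨_, ENNReal.mul_lt_top (ψ.memLp q).eLpNorm_lt_top (Lp.eLpNorm_lt_top f), fun r ↦ ?_⟩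
    have h1 := lintegral_enorm_mul_comp_sub_le hpq (k := fun t ↦ ‖ψ t‖)
      hψ.norm.aestronglyMeasurable hf.aestronglyMeasurable r
    rw [eLpNorm_norm] at h1
    refine le_trans (le_of_eq (lintegral_congr fun s ↦ ?_)) h1
    rw [enorm_norm, enorm_mul, mul_comm]
  have hηm : Measurable fun r ↦ ‖η r‖ₑ := hη.enorm.measurable
  have hηI : ∫⁻ r, ‖η r‖ₑ < ∞ := η.integrable.2
  have hlt : ∫⁻ r, ‖η r‖ₑ * D < ∞ := by
    rw [lintegral_mul_const _ hηm]
    exact ENNReal.mul_lt_top hηI hDt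
  rw [HasFiniteIntegral, Measure.volume_eq_prod, lintegral_prod _ hm.enorm.aemeasurable]
  refine lt_of_le_of_lt (lintegral_mono fun r ↦ ?_) hlt
  simp only [Function.uncurry]
  simp_rw [enorm_mul (η r)]
  rw [lintegral_const_mul' _ _ enorm_ne_top]
  exact mul_le_mul_right (hD r) _

theorem toTemperedDistribution_mollify_eq_integral {p : ℝ≥0∞} [Fact (1 ≤ p)] (hp : p ≠ ∞)
    (η : 𝓢(ℝ, ℂ)) (f : Lp ℂ p (volume : Measure ℝ)) (ψ : 𝓢(ℝ, ℂ)) :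
    Lp.toTemperedDistribution (mollify η f) ψ = ∫ s, f s * ∫ r, η r * ψ (s - r) := by
  rw [toTemperedDistribution_mollify hp]
  simp_rw [Lp.toTemperedDistribution_apply, compSubConstCLM_apply, smul_eq_mul,
    ← integral_const_mul]
  rw [integral_integral_swap (integrable_prod_schwartz_mul_Lp η ψ f)]
  refine integral_congr_ae (Filter.Eventually.of_forall fun s ↦ ?_)
  refine integral_congr_ae (Filter.Eventually.of_forall fun r ↦ ?_)
  simp only
  ring

/-- The transform at `(x, ξ)` is at most `C k(ξ) G(x)`, where `k(ξ) = (1 + ξ²)⁻¹` and `G` averages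
translates of `|f|` against `k`. Minkowski puts `G` in `L^p`, and `k` is integrable. -/
theorem mollify_mem_modulationSpace {p : ℝ≥0∞} [hp1 : Fact (1 ≤ p)] (hp : p ≠ ∞)
    (φ η : 𝓢(ℝ, ℂ)) (f : Lp ℂ p (volume : Measure ℝ)) :
    Lp.toTemperedDistribution (mollify η f) ∈ modulationSpace φ p 1 := by
  have hp0 : p ≠ 0 := (zero_lt_one.trans_le hp1.out).ne'
  have hq1 : 1 ≤ p.toReal := by
    rw [← ENNReal.toReal_one]
    exact ENNReal.toReal_mono hp hp1.out
  have hq0 : 0 < p.toReal := by linarith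
  have hf := Lp.stronglyMeasurable f
  obtain ⟨C, hCt, hC⟩ := exists_enorm_ambiguity_le η (reflectConj φ)
  set k : ℝ → ℝ≥0∞ := fun x ↦ ‖(1 + x ^ 2)⁻¹‖ₑ
  have hkm : Measurable k := by fun_prop
  have hk : ∫⁻ x : ℝ, k x < ∞ := integrable_inv_one_add_sq.2
  set G : ℝ → ℝ≥0∞ := fun x ↦ ∫⁻ y, k y * ‖f (y + x)‖ₑ
  have hfm : Measurable (fun z : ℝ × ℝ ↦ ‖f (z.2 + z.1)‖ₑ) :=
    hf.enorm.comp (measurable_snd.add measurable_fst)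
  have hGfin : ∫⁻ x, G x ^ p.toReal < ∞ := by
    refine lintegral_rpow_lintegral_lt_top hq1 (H := fun x y ↦ k y * ‖f (y + x)‖ₑ)
      ((hkm.comp measurable_snd).mul hfm) ?_
    have h1 : ∀ y, (∫⁻ x, (k y * ‖f (y + x)‖ₑ) ^ p.toReal) ^ (1 / p.toReal) =
        k y * eLpNorm f p volume := by
      intro y
      simp_rw [ENNReal.mul_rpow_of_nonneg _ _ hq0.le]
      have hm : Measurable (fun x ↦ ‖f (y + x)‖ₑ ^ p.toReal) :=
        (hf.enorm.comp (measurable_const_add y)).pow_const _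
      rw [lintegral_const_mul _ hm, ENNReal.mul_rpow_of_nonneg _ _ (by positivity),
        ← ENNReal.rpow_mul, mul_one_div_cancel hq0.ne', ENNReal.rpow_one,
        eLpNorm_eq_lintegral_rpow_enorm_toReal hp0 hp,
        lintegral_add_left_eq_self (fun x ↦ ‖f x‖ₑ ^ p.toReal)]
    simp_rw [h1]
    rw [lintegral_mul_const _ hkm]
    exact ENNReal.mul_lt_top hk (Lp.eLpNorm_lt_top f)
  have hGm : Measurable G := by
    have : Measurable (fun z : ℝ × ℝ ↦ k z.2 * ‖f (z.2 + z.1)‖ₑ) :=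
      (hkm.comp measurable_snd).mul hfm
    exact this.lintegral_prod_right'
  set N := (∫⁻ x, G x ^ p.toReal) ^ (1 / p.toReal)
  have hN : N < ∞ := ENNReal.rpow_lt_top_of_nonneg (by positivity) hGfin.ne
  have hpt : ∀ x ξ, ‖stft φ (Lp.toTemperedDistribution (mollify η f)) x ξ‖ₑ ≤ (C * k ξ) * G x := by
    intro x ξ
    rw [stft, toTemperedDistribution_mollify_eq_integral hp]
    refine (enorm_integral_le_lintegral_enorm _).trans ?_
    rw [← lintegral_add_right_eq_self _ x,
      ← lintegral_const_mul' _ _ (ENNReal.mul_ne_top hCt enorm_ne_top)]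
    refine lintegral_mono fun y ↦ ?_
    have h2 : ‖∫ r, η r * conjShift φ x ξ (y + x - r)‖ₑ = ‖ambiguity η (reflectConj φ) y ξ‖ₑ := by
      rw [← ofReal_norm, ← ofReal_norm, norm_integral_conjShift_sub, add_sub_cancel_right]
    simp only
    rw [enorm_mul, h2]
    refine (mul_le_mul_right (hC y ξ) _).trans (le_of_eq ?_)
    ring
  change modulationENorm φ p 1 _ < ∞
  rw [modulationENorm_one]
  have hlt : ∫⁻ ξ, (C * k ξ) * N < ∞ := by
    rw [lintegral_mul_const _ (hkm.const_mul _), lintegral_const_mul _ hkm]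
    exact ENNReal.mul_lt_top (ENNReal.mul_lt_top hCt.lt_top hk) hN
  refine lt_of_le_of_lt (lintegral_mono fun ξ ↦ ?_) hlt
  rw [eLpNorm_eq_lintegral_rpow_enorm_toReal hp0 hp]
  calc _ ≤ (∫⁻ x, ((C * k ξ) * G x) ^ p.toReal) ^ (1 / p.toReal) := by
        refine ENNReal.rpow_le_rpow (lintegral_mono fun x ↦ ?_) (by positivity)
        exact ENNReal.rpow_le_rpow (hpt x ξ) hq0.le
    _ = (C * k ξ) * N := by
        simp_rw [ENNReal.mul_rpow_of_nonneg _ _ hq0.le]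
        rw [lintegral_const_mul _ (hGm.pow_const _), ENNReal.mul_rpow_of_nonneg _ _ (by positivity),
          ← ENNReal.mul_rpow_of_nonneg _ _ hq0.le, ← ENNReal.rpow_mul,
          mul_one_div_cancel hq0.ne', ENNReal.rpow_one]

theorem compSubConstCLM_fourierSchwartz (ψ : 𝓢(ℝ, ℂ)) (r : ℝ) :
    (fourierSchwartz ψ).compSubConstCLM ℂ r = fourierSchwartz
      (smulLeftCLM ℂ (fun t : ℝ ↦ Complex.exp (-(Complex.I * t * (-r : ℝ)))) ψ) := by
  ext s
  rw [compSubConstCLM_apply, fourierSchwartz_apply, fourierSchwartz_apply]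
  refine integral_congr_ae (Filter.Eventually.of_forall fun t ↦ ?_)
  simp only
  rw [smulLeftCLM_apply_apply (hasTemperateGrowth_character (-r)), smul_eq_mul,
    show -(Complex.I * (t : ℂ) * ((s - r : ℝ) : ℂ)) =
      -(Complex.I * t * ((-r : ℝ) : ℂ)) + -(Complex.I * t * s) by push_cast; ring, Complex.exp_add]
  ring

/-- Translations become characters on the Fourier side, and averaging these against `η` gives the
multiplier. The argument is `-ω` because `mollify` translates by `f(r + ·)`. -/
theorem fourierDistribution_mollify {p : ℝ≥0∞} [Fact (1 ≤ p)] (hp : p ≠ ∞) (η : 𝓢(ℝ, ℂ))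
    (f : Lp ℂ p (volume : Measure ℝ)) (g : Lp ℂ 1 (volume : Measure ℝ))
    (hfg : fourierDistribution (Lp.toTemperedDistribution f) = Lp.toTemperedDistribution g)
    (ψ : 𝓢(ℝ, ℂ)) :
    fourierDistribution (Lp.toTemperedDistribution (mollify η f)) ψ =
      ∫ ω, ψ ω * (fourierSchwartz η (-ω) * g ω) := by
  have hg : Integrable g := L1.integrable_coeFn g
  obtain ⟨C, hC⟩ : ∃ C, ∀ ω, ‖ψ ω‖ ≤ C := by
    obtain ⟨C, hC⟩ := ψ.decay 0 0
    exact ⟨C, fun ω ↦ by simpa using hC.2 ω⟩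
  have hψg : Integrable fun ω ↦ ψ ω * g ω :=
    hg.bdd_mul ψ.continuous.aestronglyMeasurable (Filter.Eventually.of_forall hC)
  have hI : Integrable (Function.uncurry fun r ω : ℝ ↦
      η r * (ψ ω * Complex.exp (-(Complex.I * ω * (-r : ℝ))) * g ω)) := by
    have h1 := (η.integrable (μ := volume)).mul_prod hψg
    have h2 := h1.bdd_mul (c := 1)
      (f := fun z : ℝ × ℝ ↦ Complex.exp (-(Complex.I * z.2 * (-z.1 : ℝ))))
      (Continuous.aestronglyMeasurable (by fun_prop))
      (Filter.Eventually.of_forall fun z ↦ (norm_exp_neg_I_mul _ _).le)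
    refine h2.congr (Filter.Eventually.of_forall fun z ↦ ?_)
    simp only [Function.uncurry]
    ring
  rw [fourierDistribution_apply, toTemperedDistribution_mollify hp]
  simp_rw [compSubConstCLM_fourierSchwartz, ← fourierDistribution_apply, hfg,
    Lp.toTemperedDistribution_apply,
    smulLeftCLM_apply_apply (hasTemperateGrowth_character _), smul_eq_mul]
  simp_rw [mul_comm (Complex.exp _) (ψ _), ← integral_const_mul]
  rw [integral_integral_swap hI]
  refine integral_congr_ae (Filter.Eventually.of_forall fun ω ↦ ?_)
  simp only
  rw [fourierSchwartz_apply, ← integral_mul_const, ← integral_const_mul]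
  refine integral_congr_ae (Filter.Eventually.of_forall fun r ↦ ?_)
  simp only
  rw [show -(Complex.I * (ω : ℂ) * ((-r : ℝ) : ℂ)) = -(Complex.I * r * ((-ω : ℝ) : ℂ)) by
    push_cast; ring]
  ring

/-- The dilation `t ↦ K * ρ (K * t)`, which preserves the integral for `K > 0`. -/
noncomputable def dilate (ρ : 𝓢(ℝ, ℂ)) (K : ℝ) (hK : 0 < K) : 𝓢(ℝ, ℂ) :=
  (K : ℂ) • compCLMOfContinuousLinearEquiv ℂ
    (ContinuousLinearEquiv.unitsEquivAut ℝ (Units.mk0 K hK.ne')) ρ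

theorem dilate_apply (ρ : 𝓢(ℝ, ℂ)) (K : ℝ) (hK : 0 < K) (t : ℝ) :
    dilate ρ K hK t = K * ρ (K * t) := by
  simp [dilate, mul_comm t]

theorem integral_smul_comp_mul_left {E : Type*} [NormedAddCommGroup E] [NormedSpace ℝ E]
    (G : ℝ → E) {K : ℝ} (hK : 0 < K) : ∫ t, K • G (K * t) = ∫ t, G t := by
  rw [integral_smul, Measure.integral_comp_mul_left G K, abs_of_pos (inv_pos.2 hK), smul_smul,
    mul_inv_cancel₀ hK.ne', one_smul]

theorem fourierSchwartz_dilate (ρ : 𝓢(ℝ, ℂ)) (K : ℝ) (hK : 0 < K) (ω : ℝ) :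
    fourierSchwartz (dilate ρ K hK) ω = fourierSchwartz ρ (K⁻¹ * ω) := by
  rw [fourierSchwartz_apply, fourierSchwartz_apply, ← integral_smul_comp_mul_left
    (fun t : ℝ ↦ ρ t * Complex.exp (-(Complex.I * t * (K⁻¹ * ω : ℝ)))) hK]
  refine integral_congr_ae (Filter.Eventually.of_forall fun t ↦ ?_)
  have hK' : (K : ℂ) ≠ 0 := by exact_mod_cast hK.ne'
  simp only
  rw [dilate_apply, Complex.real_smul, mul_assoc,
    show Complex.I * (t : ℂ) * (ω : ℂ) = Complex.I * ((K * t : ℝ) : ℂ) * ((K⁻¹ * ω : ℝ) : ℂ) by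
      push_cast; field_simp]

theorem mollify_dilate {p : ℝ≥0∞} [Fact (1 ≤ p)] (ρ : 𝓢(ℝ, ℂ)) (K : ℝ) (hK : 0 < K)
    (f : Lp ℂ p (volume : Measure ℝ)) :
    mollify (dilate ρ K hK) f = ∫ r, ρ r • translateLp f (K⁻¹ * r) := by
  rw [mollify, ← integral_smul_comp_mul_left (fun r ↦ ρ r • translateLp f (K⁻¹ * r)) hK]
  refine integral_congr_ae (Filter.Eventually.of_forall fun t ↦ ?_)
  simp only
  rw [dilate_apply, inv_mul_cancel_left₀ hK.ne', ← Complex.real_smul, smul_assoc]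

theorem tendsto_inv_natCast_add_one_mul (r : ℝ) :
    Filter.Tendsto (fun n : ℕ ↦ ((n : ℝ) + 1)⁻¹ * r) Filter.atTop (nhds 0) := by
  have h := (tendsto_one_div_add_atTop_nhds_zero_nat (𝕜 := ℝ)).mul_const r
  simpa using h

/-- After rescaling, `n` occurs only in the translation by `r / (n + 1)`. Strong continuity of
translations, valid for `p ≠ ∞`, and dominated convergence give the limit. -/
theorem tendsto_mollify {p : ℝ≥0∞} [Fact (1 ≤ p)] (hp : p ≠ ∞) (ρ : 𝓢(ℝ, ℂ))
    (hρ : ∫ r, ρ r = 1) (f : Lp ℂ p (volume : Measure ℝ)) :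
    Filter.Tendsto (fun n : ℕ ↦ mollify (dilate ρ (n + 1) n.cast_add_one_pos) f) Filter.atTop
      (nhds f) := by
  simp_rw [mollify_dilate]
  have hlim : ∫ r, ρ r • f = f := by rw [integral_smul_const, hρ, one_smul]
  conv => rhs; rw [← hlim]
  refine tendsto_integral_of_dominated_convergence (fun r ↦ ‖ρ r‖ * ‖f‖)
    (fun n ↦ (integrable_smul_translateLp hp ρ f _).aestronglyMeasurable)
    (ρ.integrable.norm.mul_const _)
    (fun n ↦ Filter.Eventually.of_forall fun r ↦ by rw [norm_smul, norm_translateLp])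
    (Filter.Eventually.of_forall fun r ↦ ?_)
  have h := ((continuous_translateLp hp f).tendsto 0).comp (tendsto_inv_natCast_add_one_mul r)
  rw [translateLp_zero] at h
  exact h.const_smul (ρ r)

theorem exists_integral_eq_one {φ : 𝓢(ℝ, ℂ)} (hφ : φ ≠ 0) : ∃ ρ : 𝓢(ℝ, ℂ), ∫ r, ρ r = 1 := by
  have hpos := integral_norm_sq_pos hφ
  refine ⟨((∫ t, ‖φ t‖ ^ 2 : ℝ) : ℂ)⁻¹ • shiftMul φ (conjSchwartz φ) 0, ?_⟩
  simp_rw [smul_apply, shiftMul_apply, conjSchwartz_apply, sub_zero, smul_eq_mul, Complex.mul_conj']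
  rw [integral_const_mul]
  have : ∫ r, (‖φ r‖ : ℂ) ^ 2 = ((∫ t, ‖φ t‖ ^ 2 : ℝ) : ℂ) := by
    rw [← integral_complex_ofReal]
    simp
  rw [this, inv_mul_cancel₀ (by exact_mod_cast hpos.ne')]

/-- The multiplier is bounded and tends pointwise to `ρ̂(0) = ∫ ρ = 1`, so dominated convergence
applies. -/
theorem tendsto_lintegral_enorm_sub_fourierSchwartz_mul (ρ : 𝓢(ℝ, ℂ)) (hρ : ∫ r, ρ r = 1)
    {g : ℝ → ℂ} (hg : Integrable g) :
    Filter.Tendsto (fun n : ℕ ↦ ∫⁻ ω, ‖g ω - fourierSchwartz ρ (((n : ℝ) + 1)⁻¹ * -ω) * g ω‖ₑ)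
      Filter.atTop (nhds 0) := by
  obtain ⟨C, hC⟩ : ∃ C, ∀ ω, ‖fourierSchwartz ρ ω‖ ≤ C := by
    obtain ⟨C, hC⟩ := (fourierSchwartz ρ).decay 0 0
    exact ⟨C, fun ω ↦ by simpa using hC.2 ω⟩
  have h0 : fourierSchwartz ρ 0 = 1 := by
    rw [fourierSchwartz_apply, ← hρ]
    simp
  have hc := (fourierSchwartz ρ).continuous
  have hlim : ∫⁻ _ : ℝ, (0 : ℝ≥0∞) = 0 := lintegral_zero
  rw [← hlim]
  refine tendsto_lintegral_of_dominated_convergence' (fun ω ↦ ‖(1 + C) * ‖g ω‖‖ₑ) (fun n ↦ ?_)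
    (fun n ↦ Filter.Eventually.of_forall fun ω ↦ ?_) (hg.norm.const_mul _).2.ne
    (Filter.Eventually.of_forall fun ω ↦ ?_)
  · have h1 : AEStronglyMeasurable (fun ω ↦ fourierSchwartz ρ (((n : ℝ) + 1)⁻¹ * -ω)) volume :=
      Continuous.aestronglyMeasurable (by fun_prop)
    exact (hg.1.sub (h1.mul hg.1)).enorm
  · rw [enorm_le_iff_norm_le]
    refine le_trans ?_ (le_abs_self _)
    refine (norm_sub_le _ _).trans ?_
    rw [norm_mul, add_mul, one_mul]
    gcongr
    exact hC _
  · have h1 := (hc.tendsto 0).comp (tendsto_inv_natCast_add_one_mul (-ω))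
    rw [h0] at h1
    have h2 := (((h1.mul_const (g ω)).const_sub (g ω))).enorm
    simpa using h2

theorem exists_mem_modulationSpace_fourierSegalENorm_sub_lt {p : ℝ≥0∞} [Fact (1 ≤ p)] (hp : p ≠ ∞)
    {φ : 𝓢(ℝ, ℂ)} (hφ : φ ≠ 0) {u : 𝓢'(ℝ, ℂ)} (hu : u ∈ fourierSegalAlgebra p) {ε : ℝ≥0∞}
    (hε : 0 < ε) : ∃ v ∈ modulationSpace φ p 1, fourierSegalENorm p (u - v) < ε := by
  have hu' : lpENorm p u + lpENorm 1 (fourierDistribution u) < ∞ := hu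
  rw [ENNReal.add_lt_top] at hu'
  obtain ⟨f, rfl⟩ := (lpENorm_lt_top_iff p u).1 hu'.1
  obtain ⟨g, hfg⟩ := (lpENorm_lt_top_iff 1 _).1 hu'.2
  obtain ⟨ρ, hρ⟩ := exists_integral_eq_one hφ
  have hg : Integrable g := L1.integrable_coeFn g
  have h1 : Filter.Tendsto
      (fun n : ℕ ↦ ‖f - mollify (dilate ρ (n + 1) n.cast_add_one_pos) f‖ₑ) Filter.atTop (nhds 0) := by
    simpa using ((tendsto_mollify hp ρ hρ f).const_sub f).enorm
  have h2 := h1.add (tendsto_lintegral_enorm_sub_fourierSchwartz_mul ρ hρ hg)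
  rw [add_zero] at h2
  obtain ⟨n, hn⟩ := (h2.eventually_lt_const hε).exists
  set η := dilate ρ ((n : ℝ) + 1) n.cast_add_one_pos with hη
  refine ⟨Lp.toTemperedDistribution (mollify η f), mollify_mem_modulationSpace hp φ η f,
    lt_of_le_of_lt ?_ hn⟩
  obtain ⟨C, hC⟩ : ∃ C, ∀ ω, ‖fourierSchwartz η ω‖ ≤ C := by
    obtain ⟨C, hC⟩ := (fourierSchwartz η).decay 0 0
    exact ⟨C, fun ω ↦ by simpa using hC.2 ω⟩
  have hG : Integrable fun ω ↦ fourierSchwartz η (-ω) * g ω := by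
    refine hg.bdd_mul (c := C) ?_ (Filter.Eventually.of_forall fun ω ↦ hC _)
    have := (fourierSchwartz η).continuous
    exact Continuous.aestronglyMeasurable (by fun_prop)
  have hG1 := memLp_one_iff_integrable.2 hG
  have hGd : fourierDistribution (Lp.toTemperedDistribution (mollify η f)) =
      Lp.toTemperedDistribution (hG1.toLp _) := by
    ext ψ
    rw [fourierDistribution_mollify hp η f g hfg.symm, Lp.toTemperedDistribution_apply]
    refine integral_congr_ae ?_
    filter_upwards [hG1.coeFn_toLp] with ω hω
    rw [hω, smul_eq_mul]
  have e1 : Lp.toTemperedDistribution f - Lp.toTemperedDistribution (mollify η f) =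
      Lp.toTemperedDistribution (f - mollify η f) :=
    (map_sub (Lp.toTemperedDistributionCLM ℂ volume p) f (mollify η f)).symm
  have e2 : fourierDistribution
      (Lp.toTemperedDistribution f - Lp.toTemperedDistribution (mollify η f)) =
      Lp.toTemperedDistribution (g - hG1.toLp _) := by
    rw [fourierDistribution, map_sub]
    change fourierDistribution _ - fourierDistribution _ = _
    rw [← hfg, hGd]
    exact (map_sub (Lp.toTemperedDistributionCLM ℂ volume 1) g (hG1.toLp _)).symm
  rw [fourierSegalENorm, e2, e1, lpENorm_toTemperedDistribution, lpENorm_toTemperedDistribution]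
  refine le_of_eq (congrArg _ ?_)
  rw [Lp.enorm_def, eLpNorm_one_eq_lintegral_enorm]
  refine lintegral_congr_ae ?_
  filter_upwards [Lp.coeFn_sub g (hG1.toLp _), hG1.coeFn_toLp] with ω h3 h4
  rw [h3, Pi.sub_apply, h4, hη, fourierSchwartz_dilate]

/-! ### Spike trains and strictness of the inclusion -/

theorem memLp_of_integrable_of_norm_le {f : ℝ → ℂ} (hf : Integrable f) {C : ℝ}
    (hC : ∀ x, ‖f x‖ ≤ C) (p : ℝ≥0∞) (hp : 1 ≤ p) : MemLp f p := by
  have hC0 : 0 ≤ C := (norm_nonneg _).trans (hC 0)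
  have h := memLp_of_norm_le_one (hf.norm.const_mul (1 + C)⁻¹) (fun x ↦ ?_) p hp
  · have h2 := h.const_mul (1 + C)
    refine (memLp_norm_iff hf.aestronglyMeasurable).1 (h2.congr_norm
      hf.norm.aestronglyMeasurable (Filter.Eventually.of_forall fun x ↦ ?_))
    rw [mul_inv_cancel_left₀ (by positivity)]
  · rw [norm_mul, norm_norm, norm_inv, Real.norm_of_nonneg (by positivity : 0 ≤ 1 + C)]
    exact inv_mul_le_one_of_le₀ (by linarith [hC x]) (by positivity)

/-- The `L¹` norm of the Fourier transform of `φ` is controlled by the `H¹` norm of `φ`. -/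
theorem integral_norm_fourierSchwartz_le (φ : 𝓢(ℝ, ℂ)) :
    ∫ ω, ‖fourierSchwartz φ ω‖ ≤ Real.pi + 2 * Real.pi * (∫ t, ‖φ t‖ ^ 2) +
      2 * Real.pi * ∫ t, ‖derivCLM ℂ ℂ φ t‖ ^ 2 := by
  rw [← integral_norm_sq_fourierSchwartz, ← integral_norm_sq_fourierSchwartz,
    ← integral_univ_inv_one_add_sq]
  have hsq : ∀ χ : 𝓢(ℝ, ℂ), Integrable fun t ↦ ‖χ t‖ ^ 2 := fun χ ↦
    (memLp_two_iff_integrable_sq_norm χ.continuous.aestronglyMeasurable).1 (χ.memLp 2)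
  have hI : Integrable fun ω : ℝ ↦ (1 + ω ^ 2)⁻¹ + ‖fourierSchwartz φ ω‖ ^ 2 :=
    integrable_inv_one_add_sq.add (hsq _)
  rw [← integral_add integrable_inv_one_add_sq (hsq _), ← integral_add hI (hsq _)]
  refine integral_mono (SchwartzMap.integrable _).norm (hI.add (hsq _)) fun ω ↦ ?_
  simp only
  rw [fourierSchwartz_derivCLM, norm_mul, norm_mul, Complex.norm_I, one_mul, Complex.norm_real,
    mul_pow, Real.norm_eq_abs, sq_abs, add_assoc, ← one_add_mul]
  set a := ‖fourierSchwartz φ ω‖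
  have h1 : (0 : ℝ) < 1 + ω ^ 2 := by positivity
  have h2 : a = ((1 + ω ^ 2)⁻¹ * a) * (1 + ω ^ 2) := by field_simp
  -- A completed square giving `2a ≤ (1 + ω²)⁻¹ + (1 + ω²) a²`.
  have h3 : 0 ≤ (1 + ω ^ 2)⁻¹ * ((1 + ω ^ 2) * a - 1) ^ 2 := by positivity
  have h4 : (1 + ω ^ 2)⁻¹ * ((1 + ω ^ 2) * a - 1) ^ 2 =
      (1 + ω ^ 2) * a ^ 2 - 2 * a + (1 + ω ^ 2)⁻¹ := by field_simp; ring
  have h5 : 0 ≤ a := norm_nonneg _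
  linarith

theorem norm_sum_sq_of_pairwise_mul_eq_zero {ι : Type*} (s : Finset ι) (x : ι → ℂ)
    (h : ∀ i j, i ≠ j → x i = 0 ∨ x j = 0) : ‖∑ i ∈ s, x i‖ ^ 2 = ∑ i ∈ s, ‖x i‖ ^ 2 := by
  by_cases hs : ∃ i ∈ s, x i ≠ 0
  · obtain ⟨i, hi, hxi⟩ := hs
    have h0 : ∀ j, j ≠ i → x j = 0 := fun j hj ↦ (h j i hj).resolve_right hxi
    rw [Finset.sum_eq_single_of_mem i hi fun j _ hj ↦ h0 j hj,
      Finset.sum_eq_single_of_mem i hi fun j _ hj ↦ by rw [h0 j hj]; simp]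
  · push Not at hs
    rw [Finset.sum_eq_zero hs, Finset.sum_eq_zero fun i hi ↦ by rw [hs i hi]; simp]
    simp

/-- The `n`-th term `t ↦ a_n K_n β(K_n (t - n))` of a train of rescaled copies of `β`. -/
noncomputable def spike (β : 𝓢(ℝ, ℂ)) (a K : ℕ → ℝ) (hK : ∀ n, 0 < K n) (n : ℕ) : 𝓢(ℝ, ℂ) :=
  (a n : ℂ) • (dilate β (K n) (hK n)).compSubConstCLM ℂ (n : ℝ)

section spike

variable {β : 𝓢(ℝ, ℂ)} {a K : ℕ → ℝ} {hK : ∀ n, 0 < K n}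

theorem spike_apply (n : ℕ) (t : ℝ) :
    spike β a K hK n t = a n * K n * β (K n * (t - n)) := by
  rw [spike, smul_apply, compSubConstCLM_apply, dilate_apply, smul_eq_mul, mul_assoc]

/-- Differentiation keeps the spike form, with amplitude `a_n K_n`. The `L²` formula for spikes thus
also covers derivatives and produces `∑ a_n² K_n³`. -/
theorem derivCLM_spike (n : ℕ) : derivCLM ℂ ℂ (spike β a K hK n) =
    spike (derivCLM ℂ ℂ β) (fun n ↦ a n * K n) K hK n := by
  ext t
  rw [derivCLM_apply, spike_apply, derivCLM_apply]
  have h1 : HasDerivAt (fun t : ℝ ↦ K n * (t - n)) (K n) t := by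
    simpa using ((hasDerivAt_id t).sub_const (n : ℝ)).const_mul (K n)
  have h2 := (β.differentiable (K n * (t - n))).hasDerivAt.scomp t h1
  have h3 := (h2.const_mul (a n * K n : ℂ)).deriv
  have h4 : (spike β a K hK n : ℝ → ℂ) = fun t ↦ a n * K n * (β ∘ fun t : ℝ ↦ K n * (t - n)) t := by
    funext s
    rw [spike_apply]
    rfl
  rw [h4, h3, Complex.real_smul]
  push_cast
  ring

theorem integral_norm_spike (ha : ∀ n, 0 ≤ a n) (n : ℕ) :
    ∫ t, ‖spike β a K hK n t‖ = a n * ∫ t, ‖β t‖ := by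
  rw [← integral_smul_comp_mul_left (fun t ↦ ‖β t‖) (hK n),
    ← integral_sub_right_eq_self (fun t ↦ K n • ‖β (K n * t)‖) (n : ℝ), ← integral_const_mul]
  refine integral_congr_ae (Filter.Eventually.of_forall fun t ↦ ?_)
  simp only
  rw [spike_apply, norm_mul, norm_mul, Complex.norm_real, Complex.norm_real,
    Real.norm_of_nonneg (ha n), Real.norm_of_nonneg (hK n).le, smul_eq_mul, mul_assoc]

theorem integral_norm_sq_spike (n : ℕ) :
    ∫ t, ‖spike β a K hK n t‖ ^ 2 = a n ^ 2 * K n * ∫ t, ‖β t‖ ^ 2 := by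
  rw [← integral_smul_comp_mul_left (fun t ↦ ‖β t‖ ^ 2) (hK n),
    ← integral_sub_right_eq_self (fun t ↦ K n • ‖β (K n * t)‖ ^ 2) (n : ℝ), ← integral_const_mul]
  refine integral_congr_ae (Filter.Eventually.of_forall fun t ↦ ?_)
  simp only
  rw [spike_apply, norm_mul, norm_mul, Complex.norm_real, Complex.norm_real, mul_pow, mul_pow,
    Real.norm_eq_abs, Real.norm_eq_abs, sq_abs, sq_abs, smul_eq_mul]
  ring

theorem spike_eq_zero (hβ : ∀ t, 1 / 2 ≤ |t| → β t = 0) (hK1 : ∀ n, 1 ≤ K n) {n : ℕ} {t : ℝ}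
    (ht : 1 / 2 ≤ |t - n|) : spike β a K hK n t = 0 := by
  rw [spike_apply, hβ, mul_zero]
  rw [abs_mul, abs_of_pos (hK n)]
  nlinarith [hK1 n]

theorem half_le_abs_sub_natCast {m n : ℕ} (hmn : m ≠ n) {t : ℝ} (h : |t - m| < 1 / 2) :
    1 / 2 ≤ |t - n| := by
  have h1 : (1 : ℝ) ≤ |(m : ℝ) - n| := by
    have : (1 : ℤ) ≤ |(m : ℤ) - n| := Int.one_le_abs (sub_ne_zero.2 (by exact_mod_cast hmn))
    exact_mod_cast this
  have h2 := abs_sub_le (m : ℝ) t n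
  rw [abs_sub_comm (m : ℝ) t] at h2
  linarith

theorem spike_eq_zero_or (hβ : ∀ t, 1 / 2 ≤ |t| → β t = 0) (hK1 : ∀ n, 1 ≤ K n) (t : ℝ) (m n : ℕ)
    (hmn : m ≠ n) : spike β a K hK m t = 0 ∨ spike β a K hK n t = 0 := by
  rcases le_or_gt (1 / 2) |t - m| with h | h
  · exact Or.inl (spike_eq_zero hβ hK1 h)
  · exact Or.inr (spike_eq_zero hβ hK1 (half_le_abs_sub_natCast hmn h))

theorem sum_schwartzMap_apply (s : Finset ℕ) (F : ℕ → 𝓢(ℝ, ℂ)) (t : ℝ) :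
    (∑ n ∈ s, F n) t = ∑ n ∈ s, F n t := by
  induction s using Finset.cons_induction with
  | empty => simp
  | cons i s hi ih => rw [Finset.sum_cons, Finset.sum_cons, add_apply, ih]

theorem integral_norm_sq_sum_spike (hβ : ∀ t, 1 / 2 ≤ |t| → β t = 0) (hK1 : ∀ n, 1 ≤ K n)
    (s : Finset ℕ) : ∫ t, ‖(∑ n ∈ s, spike β a K hK n) t‖ ^ 2 =
      (∑ n ∈ s, a n ^ 2 * K n) * ∫ t, ‖β t‖ ^ 2 := by
  have h : ∀ t, ‖(∑ n ∈ s, spike β a K hK n) t‖ ^ 2 = ∑ n ∈ s, ‖spike β a K hK n t‖ ^ 2 := by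
    intro t
    rw [sum_schwartzMap_apply]
    exact norm_sum_sq_of_pairwise_mul_eq_zero s _ fun m n hmn ↦ spike_eq_zero_or hβ hK1 t m n hmn
  simp_rw [h]
  rw [integral_finsetSum s fun n _ ↦
    (memLp_two_iff_integrable_sq_norm (spike β a K hK n).continuous.aestronglyMeasurable).1
      ((spike β a K hK n).memLp 2), Finset.sum_mul]
  exact Finset.sum_congr rfl fun n _ ↦ integral_norm_sq_spike n

/-- The sum `∑ a_n K_n β(K_n (t - n))`. -/
noncomputable def spikeTrain (β : 𝓢(ℝ, ℂ)) (a K : ℕ → ℝ) (hK : ∀ n, 0 < K n) (t : ℝ) : ℂ :=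
  ∑' n, spike β a K hK n t

theorem spikeTrain_eq_spike (hβ : ∀ t, 1 / 2 ≤ |t| → β t = 0) (hK1 : ∀ n, 1 ≤ K n) {t : ℝ} {n : ℕ}
    (h : |t - n| < 1 / 2) : spikeTrain β a K hK t = spike β a K hK n t :=
  tsum_eq_single n fun _ hm ↦ spike_eq_zero hβ hK1 (half_le_abs_sub_natCast hm.symm h)

theorem integrable_spikeTrain (ha : ∀ n, 0 ≤ a n) (hsum : Summable a) :
    Integrable (spikeTrain β a K hK) := by
  have hm : Measurable (spikeTrain β a K hK) :=
    Measurable.tsum fun n ↦ (spike β a K hK n).continuous.measurable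
  refine ⟨hm.aestronglyMeasurable, ?_⟩
  have h1 : ∫⁻ t, ∑' n, ‖spike β a K hK n t‖ₑ < ∞ := by
    rw [lintegral_tsum fun n ↦ (spike β a K hK n).continuous.enorm.measurable.aemeasurable]
    have h2 : ∀ n, ∫⁻ t, ‖spike β a K hK n t‖ₑ = ENNReal.ofReal (a n * ∫ t, ‖β t‖) := fun n ↦ by
      rw [← integral_norm_spike (K := K) (hK := hK) ha, ofReal_integral_norm_eq_lintegral_enorm
        (spike β a K hK n).integrable]
    simp_rw [h2]
    exact (hsum.mul_right _).tsum_ofReal_lt_top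
  exact lt_of_le_of_lt (lintegral_mono fun t ↦ enorm_tsum_le_tsum_enorm) h1

theorem norm_spikeTrain_le (hβ : ∀ t, 1 / 2 ≤ |t| → β t = 0) (hK1 : ∀ n, 1 ≤ K n)
    (ha : ∀ n, 0 ≤ a n) (haK : ∀ n, a n * K n ≤ 1) {C : ℝ} (hC : ∀ t, ‖β t‖ ≤ C) (t : ℝ) :
    ‖spikeTrain β a K hK t‖ ≤ C := by
  by_cases h : ∃ n : ℕ, |t - n| < 1 / 2
  · obtain ⟨n, hn⟩ := h
    rw [spikeTrain_eq_spike hβ hK1 hn, spike_apply, norm_mul, norm_mul, Complex.norm_real,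
      Complex.norm_real, Real.norm_of_nonneg (ha n), Real.norm_of_nonneg (hK n).le]
    exact (mul_le_of_le_one_left (norm_nonneg _) (haK n)).trans (hC _)
  · push Not at h
    have : spikeTrain β a K hK t = 0 := by
      rw [spikeTrain]
      simp_rw [spike_eq_zero hβ hK1 (h _), tsum_zero]
    rw [this, norm_zero]
    exact (norm_nonneg _).trans (hC 0)

theorem hasSum_fourierSchwartz_spike (ha : ∀ n, 0 ≤ a n) (hsum : Summable a) (ξ : ℝ) :
    HasSum (fun n ↦ fourierSchwartz (spike β a K hK n) ξ)
      (fourierFun (spikeTrain β a K hK) ξ) := by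
  have hn : ∀ n t, ‖spike β a K hK n t * Complex.exp (-(Complex.I * t * ξ))‖ =
      ‖spike β a K hK n t‖ := fun n t ↦ by rw [norm_mul, norm_exp_neg_I_mul, mul_one]
  have h := hasSum_integral_of_summable_integral_norm (μ := (volume : Measure ℝ))
    (F := fun n t ↦ spike β a K hK n t * Complex.exp (-(Complex.I * t * ξ))) (fun n ↦ ?_) ?_
  · simp_rw [fourierSchwartz_apply, fourierFun, spikeTrain, ← tsum_mul_right]
    exact h
  · refine (spike β a K hK n).integrable.mono
      ((spike β a K hK n).continuous.mul (by fun_prop)).aestronglyMeasurable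
      (Filter.Eventually.of_forall fun t ↦ (hn n t).le)
  · simp_rw [hn, integral_norm_spike ha]
    exact hsum.mul_right _

/-- Disjoint supports make squared `L²` norms additive, so the partial sums are bounded in `H¹` and
their Fourier transforms are bounded in `L¹`. Fatou's lemma passes to the limit. -/
theorem integrable_fourierFun_spikeTrain (hβ : ∀ t, 1 / 2 ≤ |t| → β t = 0)
    (hβ' : ∀ t, 1 / 2 ≤ |t| → derivCLM ℂ ℂ β t = 0) (hK1 : ∀ n, 1 ≤ K n)
    (ha : ∀ n, 0 ≤ a n) (hsum : Summable a) (hsum3 : Summable fun n ↦ a n ^ 2 * K n ^ 3) :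
    Integrable (fourierFun (spikeTrain β a K hK)) := by
  set g := fun N ↦ ∑ n ∈ Finset.range N, spike β a K hK n with hgdef
  set S := ∑' n, a n ^ 2 * K n ^ 3
  have hS : ∀ N, ∑ n ∈ Finset.range N, a n ^ 2 * K n ^ 3 ≤ S := fun N ↦
    hsum3.sum_le_tsum _ fun n _ ↦ mul_nonneg (sq_nonneg _) (pow_nonneg (hK n).le 3)
  have hS1 : ∀ N, ∑ n ∈ Finset.range N, a n ^ 2 * K n ≤ S := fun N ↦ by
    refine (Finset.sum_le_sum fun n _ ↦ ?_).trans (hS N)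
    exact mul_le_mul_of_nonneg_left (le_self_pow₀ (hK1 n) (by norm_num)) (sq_nonneg _)
  set C := Real.pi + 2 * Real.pi * (S * ∫ t, ‖β t‖ ^ 2) +
    2 * Real.pi * (S * ∫ t, ‖derivCLM ℂ ℂ β t‖ ^ 2) with hCdef
  have hpi := Real.pi_pos
  have hbound : ∀ N, ∫⁻ ω, ‖fourierSchwartz (g N) ω‖ₑ ≤ ENNReal.ofReal C := by
    intro N
    rw [← ofReal_integral_norm_eq_lintegral_enorm (fourierSchwartz (g N)).integrable]
    refine ENNReal.ofReal_le_ofReal ((integral_norm_fourierSchwartz_le _).trans ?_)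
    have hd : derivCLM ℂ ℂ (g N) =
        ∑ n ∈ Finset.range N, spike (derivCLM ℂ ℂ β) (fun n ↦ a n * K n) K hK n := by
      simp_rw [hgdef, map_sum, derivCLM_spike]
    rw [hd, integral_norm_sq_sum_spike hβ' hK1, integral_norm_sq_sum_spike hβ hK1]
    have h1 : ∑ n ∈ Finset.range N, (a n * K n) ^ 2 * K n ≤ S := by
      refine le_trans (le_of_eq (Finset.sum_congr rfl fun n _ ↦ ?_)) (hS N)
      ring
    have h2 : 0 ≤ ∫ t, ‖β t‖ ^ 2 := integral_nonneg fun t ↦ sq_nonneg _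
    have h3 : 0 ≤ ∫ t, ‖derivCLM ℂ ℂ β t‖ ^ 2 := integral_nonneg fun t ↦ sq_nonneg _
    have h4 := mul_le_mul_of_nonneg_right (hS1 N) h2
    have h5 := mul_le_mul_of_nonneg_right h1 h3
    have h6 := mul_le_mul_of_nonneg_left h4 (by positivity : 0 ≤ 2 * Real.pi)
    have h7 := mul_le_mul_of_nonneg_left h5 (by positivity : 0 ≤ 2 * Real.pi)
    linarith
  have hlim : ∀ ω, Filter.Tendsto (fun N ↦ ‖fourierSchwartz (g N) ω‖ₑ) Filter.atTop
      (nhds ‖fourierFun (spikeTrain β a K hK) ω‖ₑ) := by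
    intro ω
    have h := (hasSum_fourierSchwartz_spike (β := β) (K := K) (hK := hK) ha hsum ω).tendsto_sum_nat
    simp_rw [hgdef, map_sum, sum_schwartzMap_apply]
    exact h.enorm
  refine ⟨(continuous_fourierFun (integrable_spikeTrain ha hsum)).aestronglyMeasurable, ?_⟩
  have hle : ∫⁻ ω, ‖fourierFun (spikeTrain β a K hK) ω‖ₑ ≤
      Filter.liminf (fun N ↦ ∫⁻ ω, ‖fourierSchwartz (g N) ω‖ₑ) Filter.atTop := by
    simp_rw [← (hlim _).liminf_eq]
    exact lintegral_liminf_le fun N ↦ (fourierSchwartz (g N)).continuous.enorm.measurable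
  refine lt_of_le_of_lt (hle.trans ?_) (ENNReal.ofReal_lt_top (r := C))
  exact Filter.liminf_le_of_frequently_le' (Filter.Frequently.of_forall hbound)

end spike

theorem exists_schwartz_bump : ∃ β : 𝓢(ℝ, ℂ), (∀ t, 1 / 2 ≤ |t| → β t = 0) ∧
    (∀ t, 1 / 2 ≤ |t| → derivCLM ℂ ℂ β t = 0) ∧ ∀ t, |t| ≤ 1 / 4 → β t = 1 := by
  -- The outer radius is strictly below `1/2`, so the derivative also vanishes at `|t| = 1/2`. The
  -- plateau of radius `1/4` serves the lower bound on the amalgam norm.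
  let b : ContDiffBump (0 : ℝ) := ⟨1 / 4, 1 / 3, by norm_num, by norm_num⟩
  have hs : HasCompactSupport fun t ↦ ((b t : ℝ) : ℂ) :=
    b.hasCompactSupport.comp_left (g := fun x : ℝ ↦ (x : ℂ)) Complex.ofReal_zero
  have hd : ContDiff ℝ ((⊤ : ℕ∞) : WithTop ℕ∞) fun t ↦ ((b t : ℝ) : ℂ) :=
    Complex.ofRealCLM.contDiff.comp b.contDiff
  have h0 : ∀ t : ℝ, 1 / 3 ≤ |t| → ((b t : ℝ) : ℂ) = 0 := fun t ht ↦ by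
    rw [b.zero_of_le_dist (by rw [Real.dist_0_eq_abs]; exact ht), Complex.ofReal_zero]
  refine ⟨hs.toSchwartzMap hd, fun t ht ↦ ?_, fun t ht ↦ ?_, fun t ht ↦ ?_⟩
  · exact h0 t (by linarith)
  · rw [derivCLM_apply]
    have : (hs.toSchwartzMap hd : ℝ → ℂ) =ᶠ[nhds t] fun _ ↦ 0 := by
      have h1 : ∀ᶠ s in nhds t, 1 / 3 < |s| :=
        continuous_abs.continuousAt.eventually_const_lt (by linarith)
      filter_upwards [h1] with s hs'
      exact h0 s hs'.le
    rw [this.deriv_eq, deriv_const]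
  · change ((b t : ℝ) : ℂ) = 1
    rw [b.one_of_mem_closedBall (mem_closedBall_zero_iff.2 ht), Complex.ofReal_one]

/-- With `a_n = (n+1)^{-6/5}` and `K_n = (n+1)^{2/5}` one has `a_n K_n = (n+1)^{-4/5}`, `a_n² K_n³ =
a_n`, and `a_n √K_n` is the harmonic series. -/
theorem exists_spike_parameters : ∃ a K : ℕ → ℝ, (∀ n, 0 ≤ a n) ∧ (∀ n, 1 ≤ K n) ∧
    (∀ n, a n * K n ≤ 1) ∧ Summable a ∧ (Summable fun n ↦ a n ^ 2 * K n ^ 3) ∧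
    ¬ Summable fun n ↦ a n * √(K n) := by
  have h1 : ∀ n : ℕ, (1 : ℝ) ≤ (n : ℝ) + 1 := fun n ↦ by linarith [n.cast_nonneg (α := ℝ)]
  have h0 : ∀ n : ℕ, (0 : ℝ) < (n : ℝ) + 1 := fun n ↦ by linarith [h1 n]
  have hs : Summable fun n : ℕ ↦ ((n : ℝ) + 1) ^ (-(6 / 5) : ℝ) := by
    have := (summable_nat_add_iff 1).2 (Real.summable_nat_rpow.2 (by norm_num : (-(6 / 5) : ℝ) < -1))
    simpa using this
  refine ⟨fun n ↦ ((n : ℝ) + 1) ^ (-(6 / 5) : ℝ), fun n ↦ ((n : ℝ) + 1) ^ (2 / 5 : ℝ),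
    fun n ↦ Real.rpow_nonneg (h0 n).le _, fun n ↦ Real.one_le_rpow (h1 n) (by norm_num),
    fun n ↦ ?_, hs, ?_, ?_⟩
  · simp only
    rw [← Real.rpow_add (h0 n)]
    exact Real.rpow_le_one_of_one_le_of_nonpos (h1 n) (by norm_num)
  · refine hs.congr fun n ↦ ?_
    rw [← Real.rpow_natCast, ← Real.rpow_natCast, ← Real.rpow_mul (h0 n).le,
      ← Real.rpow_mul (h0 n).le, ← Real.rpow_add (h0 n)]
    norm_num
  · have h2 : ¬ Summable fun n : ℕ ↦ ((n : ℝ) + 1) ^ (-1 : ℝ) := by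
      have := (summable_nat_add_iff (f := fun n : ℕ ↦ (n : ℝ) ^ (-1 : ℝ)) 1).not.2
        (Real.summable_nat_rpow.not.2 (by norm_num))
      simpa using this
    refine fun h ↦ h2 (h.congr fun n ↦ ?_)
    rw [Real.sqrt_eq_rpow, ← Real.rpow_mul (h0 n).le, ← Real.rpow_add (h0 n)]
    norm_num

/-- A function of size at least `κ` on a set has large `L²` norm. -/
theorem mul_sqrt_le_eLpNorm_two {h : ℝ → ℂ} {κ c r : ℝ} (hr : 0 ≤ r)
    (hh : ∀ ω ∈ Metric.closedBall c r, κ ≤ ‖h ω‖) :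
    ENNReal.ofReal (κ * √(2 * r)) ≤ eLpNorm h 2 volume := by
  rcases le_or_gt κ 0 with hκ | hκ
  · rw [ENNReal.ofReal_of_nonpos (mul_nonpos_of_nonpos_of_nonneg hκ (Real.sqrt_nonneg _))]
    exact zero_le
  · have h1 : eLpNorm ((Metric.closedBall c r).indicator fun _ ↦ κ) 2 volume =
        ENNReal.ofReal (κ * √(2 * r)) := by
      rw [eLpNorm_indicator_const Metric.isClosed_closedBall.measurableSet two_ne_zero
        ENNReal.ofNat_ne_top, Real.volume_closedBall, ENNReal.ofReal_mul hκ.le,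
        Real.enorm_of_nonneg hκ.le, ENNReal.toReal_ofNat,
        ENNReal.ofReal_rpow_of_nonneg (by positivity) (by norm_num), Real.sqrt_eq_rpow]
    rw [← h1]
    refine eLpNorm_mono fun ω ↦ ?_
    by_cases hω : ω ∈ Metric.closedBall c r
    · rw [Set.indicator_of_mem hω, Real.norm_of_nonneg hκ.le]
      exact hh ω hω
    · rw [Set.indicator_of_notMem hω, norm_zero]
      exact norm_nonneg _

/-- The amalgam norm `W(L², ℓ¹)` of a spike train is infinite if `∑ a_n √K_n` diverges. -/
theorem lintegral_eLpNorm_spikeTrain_eq_top {β : 𝓢(ℝ, ℂ)} {a K : ℕ → ℝ} {hK : ∀ n, 0 < K n}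
    (hβ : ∀ t, 1 / 2 ≤ |t| → β t = 0) (hβ1 : ∀ t, |t| ≤ 1 / 4 → β t = 1) (hK1 : ∀ n, 1 ≤ K n)
    (ha : ∀ n, 0 ≤ a n) (hns : ¬ Summable fun n ↦ a n * √(K n)) {ψ : 𝓢(ℝ, ℂ)} (hψ : ψ ≠ 0) :
    ∫⁻ ξ, eLpNorm (fun ω ↦ 2 * Real.pi * spikeTrain β a K hK (-ω) * conj (ψ (ω - ξ))) 2 volume
      = ∞ := by
  obtain ⟨s, hs⟩ : ∃ s, ψ s ≠ 0 := by
    by_contra! h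
    exact hψ (SchwartzMap.ext h)
  have hs' : 0 < ‖ψ s‖ := norm_pos_iff.2 hs
  -- The bound `r ≤ 1/2` keeps the balls `E n`, whose centres are at least `1` apart, disjoint, and
  -- keeps `r/4` inside the plateau of `β`.
  obtain ⟨r, hr, hr1, hψr⟩ : ∃ r, 0 < r ∧ r ≤ 1 / 2 ∧ ∀ t, |t - s| < r → ‖ψ s‖ / 2 ≤ ‖ψ t‖ := by
    have h1 : ∀ᶠ t in nhds s, ‖ψ s‖ / 2 < ‖ψ t‖ :=
      ψ.continuous.norm.continuousAt.eventually_const_lt (by linarith)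
    obtain ⟨r, hr, h⟩ := Metric.eventually_nhds_iff.1 h1
    exact ⟨min r (1 / 2), by positivity, min_le_right _ _, fun t ht ↦
      (h (lt_of_lt_of_le ht (min_le_left _ _))).le⟩
  set Φ : ℝ → ℝ≥0∞ := fun ξ ↦
    eLpNorm (fun ω ↦ 2 * Real.pi * spikeTrain β a K hK (-ω) * conj (ψ (ω - ξ))) 2 volume
  set E : ℕ → Set ℝ := fun n ↦ Metric.ball (-(n : ℝ) - s) (r / 2)
  set D := 2 * Real.pi * (‖ψ s‖ / 2) * √(2 * (r / 4)) with hDdef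
  have hpi := Real.pi_pos
  have hD : 0 < D := by positivity
  -- For `ω` within `r / (4 K_n)` of `-n` the train has its peak value `a_n K_n`, and `ω - ξ` is
  -- close to `s`, where `ψ` is not small. The `L²` norm over this interval is of order `a_n K_n ·
  -- K_n^{-1/2}`.
  have hΦ : ∀ n, ∀ ξ ∈ E n, ENNReal.ofReal (D * (a n * √(K n))) ≤ Φ ξ := by
    intro n ξ hξ
    have hξ' : |ξ - (-(n : ℝ) - s)| < r / 2 := hξ
    have hK0 := hK n
    have hle : r / 4 / K n ≤ r / 4 := div_le_self (by positivity) (hK1 n)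
    have h := mul_sqrt_le_eLpNorm_two
      (h := fun ω ↦ 2 * Real.pi * spikeTrain β a K hK (-ω) * conj (ψ (ω - ξ)))
      (κ := 2 * Real.pi * (a n * K n) * (‖ψ s‖ / 2)) (c := -(n : ℝ)) (r := r / 4 / K n)
      (by positivity) fun ω hω ↦ ?_
    · refine le_trans (le_of_eq (congrArg _ ?_)) h
      rw [hDdef, show 2 * (r / 4 / K n) = 2 * (r / 4) / K n by ring, Real.sqrt_div (by positivity)]
      have h3 : √(K n) * √(K n) = K n := Real.mul_self_sqrt hK0.le
      have h4 : 0 < √(K n) := Real.sqrt_pos.2 hK0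
      field_simp
      linear_combination a n * h3
    · have hω' : |ω - -(n : ℝ)| ≤ r / 4 / K n := hω
      have h1 : |-ω - (n : ℝ)| ≤ r / 4 / K n := by
        rw [← abs_neg]
        convert hω' using 2
        ring
      have h2 : |K n * (-ω - n)| ≤ 1 / 4 := by
        rw [abs_mul, abs_of_pos hK0]
        calc K n * |-ω - n| ≤ K n * (r / 4 / K n) := by gcongr
          _ = r / 4 := by field_simp
          _ ≤ 1 / 4 := by linarith
      have h3 : ‖ψ s‖ / 2 ≤ ‖ψ (ω - ξ)‖ := by
        refine hψr _ ?_
        rw [abs_lt] at hξ' ⊢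
        rw [abs_le] at hω'
        constructor <;> linarith
      rw [spikeTrain_eq_spike hβ hK1 (n := n) (by linarith), spike_apply, hβ1 _ h2, mul_one,
        norm_mul, RCLike.norm_conj, norm_mul, norm_mul, norm_mul, Complex.norm_real,
        Complex.norm_real, Complex.norm_real, Real.norm_of_nonneg (ha n),
        Real.norm_of_nonneg hK0.le, Real.norm_of_nonneg hpi.le, Complex.norm_ofNat]
      exact mul_le_mul_of_nonneg_left h3 (by have := ha n; positivity)
  by_contra hne
  have hdisj : Pairwise (Function.onFun Disjoint E) := by
    intro m n hmn
    refine Metric.ball_disjoint_ball ?_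
    have h1 : (1 : ℝ) ≤ |(m : ℝ) - n| := by
      have : (1 : ℤ) ≤ |(m : ℤ) - n| := Int.one_le_abs (sub_ne_zero.2 (by exact_mod_cast hmn))
      exact_mod_cast this
    rw [Real.dist_eq, show -(m : ℝ) - s - (-(n : ℝ) - s) = -(m - n) by ring, abs_neg]
    linarith
  have h1 : ∑' n, ENNReal.ofReal (D * (a n * √(K n)) * r) ≤ ∫⁻ ξ, Φ ξ := by
    refine le_trans ?_ (setLIntegral_le_lintegral (⋃ n, E n) Φ)
    rw [lintegral_iUnion (fun n ↦ Metric.isOpen_ball.measurableSet) hdisj]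
    refine ENNReal.tsum_le_tsum fun n ↦ ?_
    refine le_trans (le_of_eq ?_) (setLIntegral_mono' Metric.isOpen_ball.measurableSet (hΦ n))
    rw [setLIntegral_const, Real.volume_ball, ← ENNReal.ofReal_mul' (by positivity),
      mul_div_cancel₀ _ two_ne_zero]
  have h2 : Summable fun n ↦ D * (a n * √(K n)) * r := by
    have h3 := ENNReal.summable_toReal (lt_of_le_of_lt h1 (lt_top_iff_ne_top.2 hne)).ne
    refine h3.congr fun n ↦ ENNReal.toReal_ofReal ?_
    have := ha n
    positivity
  refine hns ((h2.mul_left (D⁻¹ * r⁻¹)).congr fun n ↦ ?_)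
  field_simp

/-- The witness is `u = ĝ` for a spike train `g`, so that `û = 2π g(-·)`. Being bounded and
integrable, `ĝ` lies in `L^p`; boundedness of `g` puts `û` in `L²`, as the amalgam criterion
requires. -/
theorem exists_mem_fourierSegalAlgebra_notMem_modulationSpace {φ : 𝓢(ℝ, ℂ)} (hφ : φ ≠ 0)
    {p : ℝ≥0∞} [hp1 : Fact (1 ≤ p)] (hp : p ≤ 2) :
    ∃ u ∈ fourierSegalAlgebra p, u ∉ modulationSpace φ p 1 := by
  obtain ⟨β, hβ, hβ', hβ1⟩ := exists_schwartz_bump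
  obtain ⟨a, K, ha, hK1, haK, hsum, hsum3, hns⟩ := exists_spike_parameters
  have hK : ∀ n, 0 < K n := fun n ↦ zero_lt_one.trans_le (hK1 n)
  obtain ⟨C, hC⟩ : ∃ C, ∀ t, ‖β t‖ ≤ C := by
    obtain ⟨C, hC⟩ := β.decay 0 0
    exact ⟨C, fun t ↦ by simpa using hC.2 t⟩
  set g := spikeTrain β a K hK
  have hg : Integrable g := integrable_spikeTrain ha hsum
  have hf : Integrable (fourierFun g) :=
    integrable_fourierFun_spikeTrain hβ hβ' hK1 ha hsum hsum3
  have hfp := memLp_of_integrable_of_norm_le hf (norm_fourierFun_le g) p hp1.out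
  have hG : Integrable fun ω ↦ 2 * Real.pi * g (-ω) := hg.comp_neg.const_mul _
  have hG1 := memLp_one_iff_integrable.2 hG
  have hG2 : MemLp (fun ω ↦ 2 * Real.pi * g (-ω)) 2 := by
    refine memLp_of_integrable_of_norm_le hG (C := ‖(2 * Real.pi : ℂ)‖ * C)
      (fun ω ↦ ?_) 2 (by norm_num)
    rw [norm_mul]
    exact mul_le_mul_of_nonneg_left (norm_spikeTrain_le hβ hK1 ha haK hC _) (norm_nonneg _)
  set u : 𝓢'(ℝ, ℂ) := Lp.toTemperedDistribution (hfp.toLp _)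
  have hu : ∀ ψ : 𝓢(ℝ, ℂ), fourierDistribution u ψ = ∫ ω, ψ ω * (2 * Real.pi * g (-ω)) := by
    intro ψ
    have h1 : fourierDistribution u ψ = ∫ t, fourierSchwartz ψ t * fourierFun g t := by
      rw [fourierDistribution_apply, Lp.toTemperedDistribution_apply]
      refine integral_congr_ae ?_
      filter_upwards [hfp.coeFn_toLp] with t ht
      rw [ht, smul_eq_mul]
    rw [h1, ← integral_fourierSchwartz_mul hg,
      ← integral_neg_eq_self (fun ω ↦ ψ ω * (2 * Real.pi * g (-ω)))]
    refine integral_congr_ae (Filter.Eventually.of_forall fun t ↦ ?_)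
    simp only
    rw [fourierSchwartz_fourierSchwartz, neg_neg]
    ring
  refine ⟨u, ENNReal.add_lt_top.2 ⟨(lpENorm_lt_top_iff p u).2 ⟨_, rfl⟩,
    (lpENorm_lt_top_iff 1 _).2 ⟨hG1.toLp _, ?_⟩⟩, fun hmem ↦ ?_⟩
  · ext ψ
    rw [hu, Lp.toTemperedDistribution_apply]
    refine integral_congr_ae ?_
    filter_upwards [hG1.coeFn_toLp] with ω hω
    rw [hω, smul_eq_mul]
  · exact (lintegral_eLpNorm_mul_conj_fourier_lt_top (modulationSpace_subset_two hφ hp hmem)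
      hG2 hu).ne (lintegral_eLpNorm_spikeTrain_eq_top hβ hβ1 hK1 ha hns (fourierSchwartz_ne_zero hφ))

end ModulationFourierSegal

theorem mainTheorem6 (p : ℝ≥0∞) [Fact (1 ≤ p)] (hp : p ≤ 2) (φ : 𝓢(ℝ, ℂ)) (hφ : φ ≠ 0) :
    ModulationFourierSegal.modulationSpace φ p 1 ⊂ ModulationFourierSegal.fourierSegalAlgebra p ∧
      ∀ u ∈ ModulationFourierSegal.fourierSegalAlgebra p, ∀ ε : ℝ≥0∞, 0 < ε →
        ∃ v ∈ ModulationFourierSegal.modulationSpace φ p 1,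
          ModulationFourierSegal.fourierSegalENorm p (u - v) < ε := by
  have hpt : p ≠ ∞ := (hp.trans_lt ENNReal.ofNat_lt_top).ne
  obtain ⟨u, hu, hu'⟩ :=
    ModulationFourierSegal.exists_mem_fourierSegalAlgebra_notMem_modulationSpace hφ hp
  exact ⟨⟨ModulationFourierSegal.modulationSpace_subset_fourierSegalAlgebra hφ hp,
      fun h ↦ hu' (h hu)⟩,
    fun _ hu _ hε ↦
      ModulationFourierSegal.exists_mem_modulationSpace_fourierSegalENorm_sub_lt hpt hφ hu hε⟩
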